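/- Setting. A base station (BS) with $M$ antennas serves $K_I$ information users (IUs) directly and $K_E$ energy users (EUs) through a RIS with $N\ge 1$ elements. The IU channels are $\mathbf h_k=\sqrt{\beta_{BI,k}}\,\tilde{\mathbf h}_k$; the EU channels are $\mathbf g_\ell=\sqrt{\lambda_\ell\delta}\,\bar{\mathbf H}_2\mathbf\Theta\bar{\mathbf f}_\ell+\sqrt{\lambda_\ell}\,\tilde{\mathbf H}_2\mathbf\Theta\bar{\mathbf f}_\ell$ with $\lambda_\ell=\beta_{RE,\ell}\beta/(\delta+1)$, $\beta_{BI,k},\beta_{RE,\ell},\beta>0$, $\delta\ge 0$, $\mathbf\Theta=\mathrm{diag}(e^{j\psi_1},\dots,e^{j\psi_N})$, $\bar{\mathbf H}_2=\mathbf a_M\mathbf a_N^H$, where $\mathbf a_M,\mathbf a_N,\bar{\mathbf f}_\ell$ are deterministic with unit-modulus entries. The users send unit-norm pilots of length $\tau=\tau_I+\tau_E\le\tau_c$ with power $p>0$: IU $k$ uses column $\boldsymbol\varphi_{i_k}$ of $\mathbf\Phi_I\in\mathbb C^{\tau\times\tau_I}$ and EU $\ell$ uses column $\bar{\boldsymbol\varphi}_{i_\ell}$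 of $\mathbf\Phi_E\in\mathbb C^{\tau\times\tau_E}$, where all columns of $[\mathbf\Phi_I,\mathbf\Phi_E]$ are orthonormal; several IUs may share a pilot, and so may several EUs. The BS receives $\mathbf Y_p=\sqrt{\tau p}\sum_\ell\mathbf g_\ell\bar{\boldsymbol\varphi}_{i_\ell}^H+\sqrt{\tau p}\sum_k\mathbf h_k\boldsymbol\varphi_{i_k}^H+\mathbf N$. The entries of $\tilde{\mathbf h}_k$ and $\tilde{\mathbf H}_2$ are $\mathcal{CN}(0,1)$, those of $\mathbf N$ are $\mathcal{CN}(0,\sigma_n^2)$ with $\sigma_n^2>0$, and all are independent. Let $\hat{\mathbf H}_1=\mathbf Y_p\mathbf\Phi_I$, let $\hat{\mathbf h}_k$ be the MMSE estimate of $\mathbf h_k$ from $\mathbf Y_p\boldsymbol\varphi_{i_k}$, and let $\hat{\mathbf g}_\ell=c_{g_\ell}\big(\mathbf Y_p\bar{\boldsymbol\varphi}_{i_\ell}-\mathbb E\{\mathbf Y_p\bar{\boldsymbol\varphi}_{i_\ell}\}\big)+\mathbb E\{\mathbf g_\ell\}$ with $$c_{g_\ell}=\frac{\sqrt{\tau p}\,N\lambda_\ell}{\tau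 p\big(\sum_{\ell'}N\lambda_{\ell'}|\bar{\boldsymbol\varphi}_{i_{\ell'}}^H\bar{\boldsymbol\varphi}_{i_\ell}|^2+\sum_{k}\beta_{BI,k}|\boldsymbol\varphi_{i_k}^H\bar{\boldsymbol\varphi}_{i_\ell}|^2\big)+\sigma_n^2}.$$ Alternatively, $\hat{\mathbf g}_\ell$ may be the MMSE estimate of $\mathbf g_\ell$ computed from the exact covariance matrices, provided that $\mathbb E\|\mathbf B\hat{\mathbf g}_\ell\|^2\neq 0$ for the matrix $\mathbf B$ defined next. With $\mathbf B=\mathbf I_M-\hat{\mathbf H}_1(\hat{\mathbf H}_1^H\hat{\mathbf H}_1)^{-1}\hat{\mathbf H}_1^H$, the protective partial zero-forcing (PPZF) precoders are $$\mathbf w_{I,k}=\frac{\hat{\mathbf H}_1(\hat{\mathbf H}_1^H\hat{\mathbf H}_1)^{-1}\mathbf e_{i_k}}{\sqrt{\mathbb E\|\hat{\mathbf H}_1(\hat{\mathbf H}_1^H\hat{\mathbf H}_1)^{-1}\mathbf e_{i_k}\|^2}},\qquad \mathbf w_{E,\ell}=\frac{\mathbf B\hat{\mathbf g}_\ell}{\sqrt{\mathbb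 E\|\mathbf B\hat{\mathbf g}_\ell\|^2}} .$$ With transmit powers $p_{I,k},p_{E,\ell}\ge 0$, $\rho_{I,k}=p_{I,k}/\sigma_n^2$ and $\rho_{E,\ell}=p_{E,\ell}/\sigma_n^2$, the achievable (hardening-bound) spectral efficiency of IU $k$ is $\mathrm{SE}_k=(1-\tau/\tau_c)\log_2(1+\mathrm{SINR}_k)$, where $$\mathrm{SINR}_k=\frac{\rho_{I,k}|\mathbb E\{\mathbf h_k^H\mathbf w_{I,k}\}|^2}{\sum_{t}\rho_{I,t}\mathbb E\{|\mathbf h_k^H\mathbf w_{I,t}|^2\}+\sum_{\ell}\rho_{E,\ell}\mathbb E\{|\mathbf h_k^H\mathbf w_{E,\ell}|^2\}-\rho_{I,k}|\mathbb E\{\mathbf h_k^H\mathbf w_{I,k}\}|^2+1}.$$ Proposition. Let $M>\tau_I$. Then $\hat{\mathbf H}_1$ has full column rank almost surely, all the expectations above are finite, the precoders are well defined with $\mathbb E\|\mathbf w_{I,t}\|^2=\mathbb E\|\mathbf w_{E,\ell}\|^2=1$, and every entry $m$ of $\hat{\mathbf h}_k$ has mean square $\mathbb E\{|[\hat{\mathbf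 h}_k]_m|^2\}=\gamma_{\hat h_k}$, where $$\gamma_{\hat h_k}=\frac{\tau p\,\beta_{BI,k}^2}{\tau p\big(\sum_{k'}\beta_{BI,k'}|\boldsymbol\varphi_{i_{k'}}^H\boldsymbol\varphi_{i_k}|^2+\sum_\ell N\lambda_\ell|\bar{\boldsymbol\varphi}_{i_\ell}^H\boldsymbol\varphi_{i_k}|^2\big)+\sigma_n^2}.$$ For every IU $k$, with $\mathcal P_k$ the set of IUs that use the pilot of IU $k$, $$\mathrm{SINR}_k=\frac{(M-\tau_I)\rho_{I,k}\gamma_{\hat h_k}}{\sum_{t\in\mathcal P_k\setminus\{k\}}(M-\tau_I)\rho_{I,t}\gamma_{\hat h_k}+\sum_{t=1}^{K_I}\rho_{I,t}(\beta_{BI,k}-\gamma_{\hat h_k})+\sum_{\ell=1}^{K_E}\rho_{E,\ell}(\beta_{BI,k}-\gamma_{\hat h_k})+1},$$ and $\mathrm{SE}_k$ is $(1-\tau/\tau_c)\log_2(1+\cdot)$ of this value. Moreover, if every IU pilot is used and the pilots assigned to different IUs are orthogonal (so that $\tau_I=K_I$), then $\gamma_{\hat h_k}=\tau p\beta_{BI,k}^2/(\tau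 p\beta_{BI,k}+\sigma_n^2)$, $$\mathrm{SINR}_k=\frac{(M-K_I)\rho_{I,k}\gamma_{\hat h_k}}{\sum_{t=1}^{K_I}\rho_{I,t}(\beta_{BI,k}-\gamma_{\hat h_k})+\sum_{\ell=1}^{K_E}\rho_{E,\ell}(\beta_{BI,k}-\gamma_{\hat h_k})+1},$$ and $\mathrm{SE}_k$ is $(1-\tau/\tau_c)\log_2(1+\cdot)$ of this value. -/

import Mathlib

open MeasureTheory ProbabilityTheory Matrix
open scoped NNReal BigOperators

noncomputable section

namespace Swipt

/-- The circularly symmetric complex Gaussian law `CN(0, v)`: real and imaginary parts are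
independent real Gaussians `N(0, v / 2)`. -/
def circGaussian (v : ℝ≥0) : Measure ℂ :=
  ((gaussianReal 0 (v / 2)).prod (gaussianReal 0 (v / 2))).map
    (fun z : ℝ × ℝ => (⟨z.1, z.2⟩ : ℂ))

/-- The squared Euclidean norm of a complex vector. -/
def normSq {n : ℕ} (v : Fin n → ℂ) : ℝ := ∑ i, ‖v i‖ ^ 2

/-- The mean vector of a random vector. -/
def meanVec {Ω : Type*} [MeasurableSpace Ω] (P : Measure Ω) {a : ℕ} (X : Ω → Fin a → ℂ) :
    Fin a → ℂ :=
  fun i => ∫ ω, X ω i ∂P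

/-- The (cross-)covariance matrix `E{X Yᴴ} - E{X} E{Y}ᴴ`. -/
def crossCov {Ω : Type*} [MeasurableSpace Ω] (P : Measure Ω) {a b : ℕ}
    (X : Ω → Fin a → ℂ) (Y : Ω → Fin b → ℂ) : Matrix (Fin a) (Fin b) ℂ :=
  Matrix.of fun i j =>
    (∫ ω, X ω i * star (Y ω j) ∂P) - meanVec P X i * star (meanVec P Y j)

/-- The MMSE estimate of `X` from the observation `Y` (jointly Gaussian case):
`C_XY C_YY⁻¹ (Y - E{Y}) + E{X}`. -/
def mmse {Ω : Type*} [MeasurableSpace Ω] (P : Measure Ω) {a b : ℕ}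
    (X : Ω → Fin a → ℂ) (Y : Ω → Fin b → ℂ) (ω : Ω) : Fin a → ℂ :=
  (crossCov P X Y * (crossCov P Y Y)⁻¹) *ᵥ (Y ω - meanVec P Y) + meanVec P X

/-- The deterministic data of the RIS-aided SWIPT downlink: `M` antennas at the BS, `N` elements
at the RIS, `KI` information users (IUs), `KE` energy users (EUs), `τI` pilots for the IUs and
`τE` pilots for the EUs, all of length `τI + τE`. -/
structure Params (M N KI KE τI τE : ℕ) where
  /-- large-scale fading of the BS-IU links -/
  betaBI : Fin KI → ℝ
  /-- path loss of the BS-RIS link -/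
  beta : ℝ
  /-- path loss of the RIS-EU links -/
  betaRE : Fin KE → ℝ
  /-- Ricean factor of the BS-RIS link -/
  delta : ℝ
  /-- BS array response towards the RIS -/
  aM : Fin M → ℂ
  /-- RIS array response towards the BS -/
  aN : Fin N → ℂ
  /-- line-of-sight RIS-EU channels -/
  fbar : Fin KE → Fin N → ℂ
  /-- RIS phase shifts -/
  psi : Fin N → ℝ
  /-- pilot power -/
  p : ℝ
  /-- noise variance -/
  noiseVar : ℝ≥0
  /-- pilot book of the IUs, one pilot per column -/
  PhiI : Matrix (Fin (τI + τE)) (Fin τI) ℂ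
  /-- pilot book of the EUs, one pilot per column -/
  PhiE : Matrix (Fin (τI + τE)) (Fin τE) ℂ
  /-- index of the pilot used by each IU -/
  iI : Fin KI → Fin τI
  /-- index of the pilot used by each EU -/
  iE : Fin KE → Fin τE
  /-- transmit powers of the information symbols -/
  pI : Fin KI → ℝ
  /-- transmit powers of the energy symbols -/
  pE : Fin KE → ℝ
  /-- length of a coherence interval, in symbols -/
  tauC : ℕ
  betaBI_pos : ∀ k, 0 < betaBI k
  beta_pos : 0 < beta
  betaRE_pos : ∀ l, 0 < betaRE l
  delta_nonneg : 0 ≤ delta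
  aM_unimodular : ∀ m, ‖aM m‖ = 1
  aN_unimodular : ∀ n, ‖aN n‖ = 1
  fbar_unimodular : ∀ l n, ‖fbar l n‖ = 1
  p_pos : 0 < p
  noiseVar_pos : 0 < noiseVar
  PhiI_orthonormal : PhiIᴴ * PhiI = 1
  PhiE_orthonormal : PhiEᴴ * PhiE = 1
  Phi_orthogonal : PhiIᴴ * PhiE = 0
  pI_nonneg : ∀ k, 0 ≤ pI k
  pE_nonneg : ∀ l, 0 ≤ pE l
  training_le : τI + τE ≤ tauC

namespace Params

variable {M N KI KE τI τE : ℕ} (S : Params M N KI KE τI τE)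

/-- `τ p`, with `τ = τI + τE`. -/
def tauP : ℝ := ((τI + τE : ℕ) : ℝ) * S.p

/-- pilot sequence of IU `k` -/
def pilotI (k : Fin KI) : Fin (τI + τE) → ℂ := fun s => S.PhiI s (S.iI k)

/-- pilot sequence of EU `l` -/
def pilotE (l : Fin KE) : Fin (τI + τE) → ℂ := fun s => S.PhiE s (S.iE l)

/-- RIS phase shift matrix -/
def Theta : Matrix (Fin N) (Fin N) ℂ :=
  Matrix.diagonal fun n => Complex.exp (Complex.I * (S.psi n : ℂ))

/-- line-of-sight component of the BS-RIS channel -/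
def H2bar : Matrix (Fin M) (Fin N) ℂ := Matrix.vecMulVec S.aM (star S.aN)

def lam (l : Fin KE) : ℝ := S.betaRE l * S.beta / (S.delta + 1)

/-- `√(λ_ℓ δ) H̄₂ Θ f̄_ℓ`, the mean of the cascaded channel of EU `l` -/
def gMean (l : Fin KE) : Fin M → ℂ :=
  (Real.sqrt (S.lam l * S.delta) : ℂ) • ((S.H2bar * S.Theta) *ᵥ S.fbar l)

/-- SNR of the information symbol of IU `k` -/
def rhoI (k : Fin KI) : ℝ := S.pI k / S.noiseVar

/-- SNR of the energy symbol of EU `l` -/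
def rhoE (l : Fin KE) : ℝ := S.pE l / S.noiseVar

/-- coefficient of the channel estimate of IU `k` -/
def cH (k : Fin KI) : ℝ :=
  Real.sqrt S.tauP * S.betaBI k /
    (S.tauP * (∑ k', S.betaBI k' * ‖star (S.pilotI k') ⬝ᵥ S.pilotI k‖ ^ 2
      + ∑ l, (N : ℝ) * S.lam l * ‖star (S.pilotE l) ⬝ᵥ S.pilotI k‖ ^ 2) + S.noiseVar)

/-- coefficient of the channel estimate of EU `l` -/
def cG (l : Fin KE) : ℝ :=
  Real.sqrt S.tauP * ((N : ℝ) * S.lam l) /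
    (S.tauP * (∑ l', (N : ℝ) * S.lam l' * ‖star (S.pilotE l') ⬝ᵥ S.pilotE l‖ ^ 2
      + ∑ k, S.betaBI k * ‖star (S.pilotI k) ⬝ᵥ S.pilotE l‖ ^ 2) + S.noiseVar)

/-- `γ_ĥk`, the mean square of the channel estimate of IU `k` -/
def gammaH (k : Fin KI) : ℝ := Real.sqrt S.tauP * S.betaBI k * S.cH k

/-- the IUs that share the pilot of IU `k` (including `k` itself) -/
def sharing (k : Fin KI) : Finset (Fin KI) := Finset.univ.filter fun t => S.iI t = S.iI k

/-- the closed form of the SINR of IU `k` -/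
def sinrPPZF (k : Fin KI) : ℝ :=
  ((M : ℝ) - τI) * S.rhoI k * S.gammaH k /
    (∑ t ∈ (S.sharing k).erase k, ((M : ℝ) - τI) * S.rhoI t * S.gammaH k
      + ∑ t, S.rhoI t * (S.betaBI k - S.gammaH k)
      + ∑ l, S.rhoE l * (S.betaBI k - S.gammaH k) + 1)

/-- the closed form of the SINR of IU `k` for orthogonal IU pilots -/
def sinrPPZFOrth (k : Fin KI) : ℝ :=
  ((M : ℝ) - KI) * S.rhoI k * S.gammaH k /
    (∑ t, S.rhoI t * (S.betaBI k - S.gammaH k)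
      + ∑ l, S.rhoE l * (S.betaBI k - S.gammaH k) + 1)

/-- spectral efficiency, in bit/s/Hz, for a given effective SINR -/
def spectralEfficiency (sinr : ℝ) : ℝ :=
  (1 - ((τI + τE : ℕ) : ℝ) / S.tauC) * Real.logb 2 (1 + sinr)

end Params

/-- The random data: the small-scale fading of the BS-IU channels, the scattered component of the
BS-RIS channel, and the noise of the training phase; all entries are independent and circularly
symmetric complex Gaussian. -/
structure Fading {M N KI KE τI τE : ℕ} (S : Params M N KI KE τI τE)
    {Ω : Type*} [MeasurableSpace Ω] (P : Measure Ω) where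
  H1tilde : Ω → Matrix (Fin M) (Fin KI) ℂ
  H2tilde : Ω → Matrix (Fin M) (Fin N) ℂ
  noise : Ω → Matrix (Fin M) (Fin (τI + τE)) ℂ
  H1tilde_meas : ∀ m k, Measurable fun ω => H1tilde ω m k
  H2tilde_meas : ∀ m n, Measurable fun ω => H2tilde ω m n
  noise_meas : ∀ m s, Measurable fun ω => noise ω m s
  H1tilde_law : ∀ m k, P.map (fun ω => H1tilde ω m k) = circGaussian 1
  H2tilde_law : ∀ m n, P.map (fun ω => H2tilde ω m n) = circGaussian 1
  noise_law : ∀ m s, P.map (fun ω => noise ω m s) = circGaussian S.noiseVar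
  indep : iIndepFun
    (fun (i : (Fin M × Fin KI) ⊕ (Fin M × Fin N) ⊕ (Fin M × Fin (τI + τE))) (ω : Ω) =>
      match i with
      | Sum.inl a => H1tilde ω a.1 a.2
      | Sum.inr (Sum.inl a) => H2tilde ω a.1 a.2
      | Sum.inr (Sum.inr a) => noise ω a.1 a.2) P

namespace Fading

variable {M N KI KE τI τE : ℕ} {S : Params M N KI KE τI τE}
  {Ω : Type*} [MeasurableSpace Ω] {P : Measure Ω} (C : Fading S P)

/-- channel of IU `k` -/
def h (k : Fin KI) (ω : Ω) : Fin M → ℂ :=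
  fun m => (Real.sqrt (S.betaBI k) : ℂ) * C.H1tilde ω m k

/-- BS-RIS channel -/
def H2 (ω : Ω) : Matrix (Fin M) (Fin N) ℂ :=
  (Real.sqrt (S.beta / (S.delta + 1)) : ℂ) •
    ((Real.sqrt S.delta : ℂ) • S.H2bar + C.H2tilde ω)

/-- cascaded channel of EU `l` -/
def g (l : Fin KE) (ω : Ω) : Fin M → ℂ :=
  (C.H2 ω * S.Theta) *ᵥ ((Real.sqrt (S.betaRE l) : ℂ) • S.fbar l)

/-- received pilot matrix -/
def Yp (ω : Ω) : Matrix (Fin M) (Fin (τI + τE)) ℂ :=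
  (Real.sqrt S.tauP : ℂ) • ∑ l, Matrix.vecMulVec (C.g l ω) (star (S.pilotE l))
    + (Real.sqrt S.tauP : ℂ) • ∑ k, Matrix.vecMulVec (C.h k ω) (star (S.pilotI k))
    + C.noise ω

/-- projection of the received pilot matrix onto the pilot of IU `k` -/
def yI (k : Fin KI) (ω : Ω) : Fin M → ℂ := C.Yp ω *ᵥ S.pilotI k

/-- projection of the received pilot matrix onto the pilot of EU `l` -/
def yE (l : Fin KE) (ω : Ω) : Fin M → ℂ := C.Yp ω *ᵥ S.pilotE l

/-- MMSE estimate of the channel of IU `k` -/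
def hHat (k : Fin KI) : Ω → Fin M → ℂ := mmse P (C.h k) (C.yI k)

/-- the channel estimate `c_gℓ (y_ℓ - E{y_ℓ}) + E{g_ℓ}` of EU `l` -/
def gHat (l : Fin KE) (ω : Ω) : Fin M → ℂ :=
  (S.cG l : ℂ) • (C.yE l ω - (Real.sqrt S.tauP : ℂ) •
      ∑ l', (star (S.pilotE l') ⬝ᵥ S.pilotE l) • S.gMean l')
    + S.gMean l

/-- matrix of the channel estimates of the IUs, `Ĥ₁ = Y_p Φ_I` -/
def H1hat (ω : Ω) : Matrix (Fin M) (Fin τI) ℂ := C.Yp ω * S.PhiI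

/-- zero-forcing direction of IU `k`, before normalization -/
def zfBeam (k : Fin KI) (ω : Ω) : Fin M → ℂ :=
  (C.H1hat ω * ((C.H1hat ω)ᴴ * C.H1hat ω)⁻¹) *ᵥ Pi.single (S.iI k) 1

/-- zero-forcing precoder of IU `k` -/
def wZF (k : Fin KI) (ω : Ω) : Fin M → ℂ :=
  ((1 / Real.sqrt (∫ ω', normSq (C.zfBeam k ω') ∂P) : ℝ) : ℂ) • C.zfBeam k ω

/-- projection onto the orthogonal complement of the columns of `Ĥ₁` -/
def B (ω : Ω) : Matrix (Fin M) (Fin M) ℂ :=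
  1 - C.H1hat ω * ((C.H1hat ω)ᴴ * C.H1hat ω)⁻¹ * (C.H1hat ω)ᴴ

/-- protective MRT precoder built from an EU channel estimate `v` -/
def wPMRT (v : Ω → Fin M → ℂ) (ω : Ω) : Fin M → ℂ :=
  ((1 / Real.sqrt (∫ ω', normSq (C.B ω' *ᵥ v ω') ∂P) : ℝ) : ℂ) • (C.B ω *ᵥ v ω)

/-- `v` is a channel estimate of EU `l`: either the one with coefficient `c_gℓ`, or the MMSE
estimate computed from the exact covariance matrices, provided that the normalization of its
protective MRT beam is not a division by zero. The two coincide if no other EU uses the pilot of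
EU `l`; otherwise they may differ, as the cascaded channels are correlated. -/
def IsEstimate (l : Fin KE) (v : Ω → Fin M → ℂ) : Prop :=
  v = C.gHat l ∨
    (v = mmse P (C.g l) (C.yE l) ∧ (∫ ω, normSq (C.B ω *ᵥ v ω) ∂P) ≠ 0)

/-- `h_kᴴ w` -/
def rx (k : Fin KI) (w : Ω → Fin M → ℂ) (ω : Ω) : ℂ := star (C.h k ω) ⬝ᵥ w ω

/-- effective SINR of IU `k` (hardening bound) for arbitrary precoders -/
def sinr (wI : Fin KI → Ω → Fin M → ℂ) (wE : Fin KE → Ω → Fin M → ℂ) (k : Fin KI) : ℝ :=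
  S.rhoI k * ‖∫ ω, C.rx k (wI k) ω ∂P‖ ^ 2 /
    (∑ t, S.rhoI t * (∫ ω, ‖C.rx k (wI t) ω‖ ^ 2 ∂P)
      + ∑ l, S.rhoE l * (∫ ω, ‖C.rx k (wE l) ω‖ ^ 2 ∂P)
      - S.rhoI k * ‖∫ ω, C.rx k (wI k) ω ∂P‖ ^ 2 + 1)

/-- spectral efficiency of IU `k` (hardening bound) for arbitrary precoders -/
def se (wI : Fin KI → Ω → Fin M → ℂ) (wE : Fin KE → Ω → Fin M → ℂ) (k : Fin KI) : ℝ :=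
  S.spectralEfficiency (C.sinr wI wE k)

end Fading

end Swipt

end

/-!
The proof separates what the estimator knows about a channel from what it does not know.

All signals at one antenna are linear combinations of the same independent circularly symmetric
Gaussians, with coefficients that do not depend on the antenna. A linear image of such Gaussians
with pairwise orthogonal coefficient vectors is again a family of independent circularly symmetric
Gaussians (`map_linear_eq_pi_circGaussian`, by characteristic functions). By pilot orthogonality and
the choice of the MMSE coefficient, this applies to the estimation error `e = h_k - c_k y_k`, the
columns of `Ĥ₁` and the centered signal of any one energy user (`Fading.map_family`). Hence `e` is a
white vector of variance `β_k - γ_k`, independent of every precoder, as each precoder is a function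
of `Ĥ₁` and of at most one energy user's signal.

For a beam `w` independent of `e`, write `h_kᴴ w = eᴴ w + c_k y_kᴴ w`. The first term is
uncorrelated with the second and has mean square `(β_k - γ_k) E‖w‖²`
(`IsWhite.integral_norm_sq_dotProduct_add`). The second is almost surely constant: `y_k` is a column
of `Ĥ₁`, so it equals `c_k` for the zero-forcing beams of the users sharing the pilot of user `k`,
and `0` for all other zero-forcing beams and for the beams projected by `B`.

What remains is the normalization. The unnormalized zero-forcing beam of column `x_j` of `Ĥ₁` is
`Q x_j / ‖Q x_j‖²`, with `Q` the projection onto the orthogonal complement of the other `τI - 1`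
columns (`normSq_zfDir`). Given those columns, `‖Q x_j‖²` is a sum of `d = M - τI + 1` squared
moduli of independent `CN(0, s)` variables, and
`E[1 / T] = ∫ u in (0, ∞), E[exp (-u T)] = ∫ u in (0, ∞), (1 + u s)⁻ᵈ = 1 / (s (d - 1))`,
so that `E‖zfBeam‖² = 1 / ((M - τI) s)` (`lintegral_normSq_zfDir_pi`). Conditioning on the other
columns is resampling one coordinate of a product measure (`lintegral_pi_update`). The protective
beams have nonzero power because `B` differs from the identity by a matrix of rank at most `τI < M`,
hence is never zero, and the estimate of an energy user contains a white vector of positive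
variance independent of `B` (`integral_normSq_projCompl_mulVec_pos`).
-/

noncomputable section

namespace Swipt

/-! ### The circularly symmetric Gaussian law -/

instance (v : ℝ≥0) : IsProbabilityMeasure (circGaussian v) :=
  Measure.isProbabilityMeasure_map
    (Complex.measurableEquivRealProd.symm.measurable.aemeasurable)

lemma measurePreserving_circGaussian (v : ℝ≥0) :
    MeasurePreserving Complex.measurableEquivRealProd.symm
      ((gaussianReal 0 (v / 2)).prod (gaussianReal 0 (v / 2))) (circGaussian v) :=
  ⟨Complex.measurableEquivRealProd.symm.measurable, rfl⟩

lemma integral_circGaussian {E : Type*} [NormedAddCommGroup E] [NormedSpace ℝ E]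
    (v : ℝ≥0) (f : ℂ → E) :
    ∫ z, f z ∂(circGaussian v) =
      ∫ z : ℝ × ℝ, f ⟨z.1, z.2⟩ ∂((gaussianReal 0 (v / 2)).prod (gaussianReal 0 (v / 2))) :=
  ((measurePreserving_circGaussian v).integral_comp' f).symm

lemma charFun_circGaussian (v : ℝ≥0) (t : ℂ) :
    charFun (circGaussian v) t = Complex.exp (-((v * ‖t‖ ^ 2 / 4 : ℝ) : ℂ)) := by
  have h (s : ℝ) : ∫ x : ℝ, Complex.exp (((x * s : ℝ) : ℂ) * Complex.I) ∂(gaussianReal 0 (v / 2))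
      = Complex.exp (-((v * s ^ 2 / 4 : ℝ) : ℂ)) := by
    have h1 := charFun_gaussianReal (μ := 0) (v := v / 2) s
    rw [charFun_apply] at h1
    refine Eq.trans (integral_congr_ae (ae_of_all _ fun x => ?_)) (h1.trans ?_)
    · simp [mul_comm]
    · congr 1; push_cast; ring
  rw [charFun_apply, integral_circGaussian]
  have : ∀ z : ℝ × ℝ, Complex.exp ((inner ℝ (⟨z.1, z.2⟩ : ℂ) t : ℝ) * Complex.I) =
      Complex.exp (((z.1 * t.re : ℝ) : ℂ) * Complex.I) *
        Complex.exp (((z.2 * t.im : ℝ) : ℂ) * Complex.I) := by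
    intro z
    rw [← Complex.exp_add]
    congr 1
    simp [Complex.inner]
    ring
  simp_rw [this]
  rw [integral_prod_mul (fun x : ℝ => Complex.exp (((x * t.re : ℝ) : ℂ) * Complex.I))
    (fun x : ℝ => Complex.exp (((x * t.im : ℝ) : ℂ) * Complex.I)), h, h, ← Complex.exp_add]
  congr 1
  rw [← Complex.normSq_eq_norm_sq, Complex.normSq_apply]
  push_cast
  ring

lemma memLp_id_circGaussian (v : ℝ≥0) : MemLp (fun z : ℂ => z) 2 (circGaussian v) := by
  have h := memLp_id_gaussianReal' (μ := 0) (v := v / 2) 2 (by norm_num)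
  rw [← (measurePreserving_circGaussian v).map_eq]
  rw [memLp_map_measure_iff (by fun_prop)
    (Complex.measurableEquivRealProd.symm.measurable.aemeasurable)]
  have h1 : MemLp (fun z : ℝ × ℝ => (z.1 : ℂ)) 2
      ((gaussianReal 0 (v / 2)).prod (gaussianReal 0 (v / 2))) :=
    (h.comp_measurePreserving measurePreserving_fst).ofReal
  have h2 : MemLp (fun z : ℝ × ℝ => (z.2 : ℂ)) 2
      ((gaussianReal 0 (v / 2)).prod (gaussianReal 0 (v / 2))) :=
    (h.comp_measurePreserving measurePreserving_snd).ofReal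
  refine (h1.add (h2.const_mul Complex.I)).congr_norm ?_ (ae_of_all _ fun z => ?_)
  · exact (Complex.measurableEquivRealProd.symm.measurable).aestronglyMeasurable
  · congr 1
    apply Complex.ext <;> simp [Complex.measurableEquivRealProd]

lemma integral_gaussianReal_sq (v : ℝ≥0) : ∫ x, x ^ 2 ∂(gaussianReal 0 v) = v := by
  have h := variance_fun_id_gaussianReal (μ := 0) (v := v)
  rw [variance_eq_integral (by fun_prop)] at h
  simpa using h

lemma integral_norm_sq_circGaussian (v : ℝ≥0) : ∫ z, ‖z‖ ^ 2 ∂(circGaussian v) = v := by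
  have h : Integrable (fun x : ℝ => x ^ 2) (gaussianReal 0 (v / 2)) :=
    (memLp_id_gaussianReal' (μ := 0) (v := v / 2) 2 (by norm_num)).integrable_sq
  rw [integral_circGaussian]
  have (z : ℝ × ℝ) : ‖(⟨z.1, z.2⟩ : ℂ)‖ ^ 2 = z.1 ^ 2 + z.2 ^ 2 := by
    rw [← Complex.normSq_eq_norm_sq, Complex.normSq_apply]; ring
  simp_rw [this]
  rw [integral_add (h.comp_fst _) (h.comp_snd _), integral_fun_fst (fun x : ℝ => x ^ 2),
    integral_fun_snd (fun x : ℝ => x ^ 2), integral_gaussianReal_sq]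
  simp

lemma integral_id_circGaussian (v : ℝ≥0) : ∫ z, z ∂(circGaussian v) = 0 := by
  have hi := (memLp_id_circGaussian v).integrable one_le_two
  have h := (memLp_id_gaussianReal' (μ := 0) (v := v / 2) 1 (by norm_num))
  have h0 : ∫ x, x ∂(gaussianReal 0 (v / 2)) = 0 := integral_id_gaussianReal
  apply Complex.ext
  · have := integral_re (𝕜 := ℂ) hi
    simp only [RCLike.re_to_complex] at this
    rw [← this, integral_circGaussian, integral_fun_fst (fun x : ℝ => x)]
    simp [h0]
  · have := integral_im (𝕜 := ℂ) hi
    simp only [RCLike.im_to_complex] at this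
    rw [← this, integral_circGaussian, integral_fun_snd (fun x : ℝ => x)]
    simp [h0]

lemma integral_exp_neg_mul_sq_gaussianReal {v : ℝ≥0} (hv : v ≠ 0) {u : ℝ} (hu : 0 ≤ u) :
    ∫ x, Real.exp (-u * x ^ 2) ∂(gaussianReal 0 (v / 2)) = Real.sqrt (1 / (1 + u * v)) := by
  have hv2 : v / 2 ≠ 0 := by simpa using hv
  have hv' : (0 : ℝ) < v := by positivity
  rw [integral_gaussianReal_eq_integral_smul hv2]
  have (x : ℝ) : gaussianPDFReal 0 (v / 2) x • Real.exp (-u * x ^ 2) =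
      (Real.sqrt (Real.pi * v))⁻¹ * Real.exp (-(u + 1 / v) * x ^ 2) := by
    rw [gaussianPDFReal_def, smul_eq_mul, mul_assoc, ← Real.exp_add]
    congr 1
    · congr 2; push_cast; ring
    · congr 1; push_cast; field_simp; ring
  simp_rw [this]
  rw [integral_const_mul, integral_gaussian, ← Real.sqrt_inv, ← Real.sqrt_mul (by positivity)]
  congr 1
  field_simp
  ring

/-- The Laplace transform of the exponentially distributed `‖z‖ ^ 2`. -/
lemma lintegral_exp_neg_mul_norm_sq_circGaussian {v : ℝ≥0} (hv : v ≠ 0) {u : ℝ} (hu : 0 ≤ u) :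
    ∫⁻ z, ENNReal.ofReal (Real.exp (-u * ‖z‖ ^ 2)) ∂(circGaussian v) =
      ENNReal.ofReal (1 / (1 + u * v)) := by
  have hm : Measurable fun z : ℂ => Real.exp (-u * ‖z‖ ^ 2) := by fun_prop
  rw [← ofReal_integral_eq_lintegral_ofReal _ (ae_of_all _ fun z => (Real.exp_pos _).le)]
  · congr 1
    rw [integral_circGaussian]
    have (z : ℝ × ℝ) : Real.exp (-u * ‖(⟨z.1, z.2⟩ : ℂ)‖ ^ 2) =
        Real.exp (-u * z.1 ^ 2) * Real.exp (-u * z.2 ^ 2) := by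
      rw [← Complex.normSq_eq_norm_sq, Complex.normSq_apply, ← Real.exp_add]; ring_nf
    simp_rw [this]
    rw [integral_prod_mul (fun x : ℝ => Real.exp (-u * x ^ 2))
      (fun x : ℝ => Real.exp (-u * x ^ 2)), integral_exp_neg_mul_sq_gaussianReal hv hu,
      Real.mul_self_sqrt (by positivity)]
  · refine Integrable.of_bound hm.aestronglyMeasurable 1 (ae_of_all _ fun z => ?_)
    rw [Real.norm_eq_abs, Real.abs_exp, Real.exp_le_one_iff]
    have := sq_nonneg ‖z‖
    nlinarith [mul_nonneg hu this]

lemma circGaussian_singleton_zero {v : ℝ≥0} (hv : v ≠ 0) : circGaussian v {0} = 0 := by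
  have hv2 : v / 2 ≠ 0 := by simpa using hv
  have := nullSingletonClass_gaussianReal (μ := 0) hv2
  rw [← (measurePreserving_circGaussian v).measure_preimage
    (measurableSet_singleton 0).nullMeasurableSet]
  have : Complex.measurableEquivRealProd.symm ⁻¹' {(0 : ℂ)} = {(0 : ℝ)} ×ˢ {(0 : ℝ)} := by
    ext z
    simp [Complex.measurableEquivRealProd, Prod.ext_iff]
  rw [this, Measure.prod_prod]
  simp

/-! ### Linear images of independent circularly symmetric Gaussians -/

/-- Linear combinations of independent circularly symmetric Gaussians whose coefficient vectors are
orthogonal for the weights `v` are again independent circularly symmetric Gaussians: orthogonality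
makes the joint characteristic function factor. -/
theorem map_linear_eq_pi_circGaussian {ι κ Ω : Type*} [Fintype ι] [Fintype κ] [DecidableEq κ]
    [MeasurableSpace Ω] {P : Measure Ω} [IsProbabilityMeasure P]
    {Z : ι → Ω → ℂ} (hZ : iIndepFun Z P) (hZm : ∀ i, Measurable (Z i)) (v : ι → ℝ≥0)
    (hlaw : ∀ i, P.map (Z i) = circGaussian (v i)) (A : κ → ι → ℂ) (w : κ → ℝ≥0)
    (hA : ∀ a b, ∑ i, (v i : ℂ) * (A a i * star (A b i)) = if a = b then (w a : ℂ) else 0) :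
    P.map (fun ω a => ∑ i, A a i * Z i ω) = Measure.pi fun a => circGaussian (w a) := by
  have hX : Measurable fun ω (a : κ) => ∑ i, A a i * Z i ω := by fun_prop
  have : IsProbabilityMeasure (P.map fun ω (a : κ) => ∑ i, A a i * Z i ω) :=
    Measure.isProbabilityMeasure_map hX.aemeasurable
  rw [← charFun_eq_pi_iff]
  intro t
  rw [Measure.map_map (by fun_prop) hX, charFun_apply, integral_map
    (Measurable.aemeasurable (by fun_prop)) (by fun_prop)]
  set s : ι → ℂ := fun i => ∑ a, star (A a i) * t a with hs
  have key (ω : Ω) : Complex.exp ((inner ℝ ((WithLp.toLp 2 ∘ fun ω (a : κ) =>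
      ∑ i, A a i * Z i ω) ω) t : ℝ) * Complex.I) =
      ∏ i, Complex.exp ((inner ℝ (Z i ω) (s i) : ℝ) * Complex.I) := by
    rw [← Complex.exp_sum, ← Finset.sum_mul, ← Complex.ofReal_sum]
    congr 3
    rw [PiLp.inner_apply]
    simp only [Complex.inner, Function.comp_apply, ← Complex.re_sum, hs]
    congr 1
    simp only [map_sum, map_mul, Finset.mul_sum, Finset.sum_mul, starRingEnd_apply]
    rw [Finset.sum_comm]
    refine Finset.sum_congr rfl fun i _ => Finset.sum_congr rfl fun a _ => ?_
    ring
  simp_rw [key]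
  rw [hZ.integral_fun_prod_comp (f := fun i z => Complex.exp ((inner ℝ z (s i) : ℝ) * Complex.I))
    (fun i => (hZm i).aemeasurable) (fun i => by
      exact Continuous.aestronglyMeasurable (by fun_prop))]
  have h1 (i : ι) : ∫ ω, Complex.exp ((inner ℝ (Z i ω) (s i) : ℝ) * Complex.I) ∂P =
      Complex.exp (-((v i * ‖s i‖ ^ 2 / 4 : ℝ) : ℂ)) := by
    rw [← charFun_circGaussian, ← hlaw i, charFun_apply,
      integral_map (hZm i).aemeasurable (Continuous.aestronglyMeasurable (by fun_prop))]
  simp_rw [h1, charFun_circGaussian, ← Complex.exp_sum]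
  congr 1
  have h2 : ∑ i, (v i : ℂ) * (s i * star (s i)) = ∑ a, (w a : ℂ) * (t a * star (t a)) := by
    calc ∑ i, (v i : ℂ) * (s i * star (s i))
        = ∑ i, ∑ a, ∑ b, (v i : ℂ) * (A b i * star (A a i)) * (t a * star (t b)) := by
          refine Finset.sum_congr rfl fun i _ => ?_
          rw [hs]
          simp only [star_sum, star_mul', star_star]
          rw [Finset.sum_mul_sum, Finset.mul_sum]
          refine Finset.sum_congr rfl fun a _ => ?_
          rw [Finset.mul_sum]
          refine Finset.sum_congr rfl fun b _ => ?_
          ring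
      _ = ∑ a, ∑ b, (∑ i, (v i : ℂ) * (A b i * star (A a i))) * (t a * star (t b)) := by
          rw [Finset.sum_comm]
          refine Finset.sum_congr rfl fun a _ => ?_
          rw [Finset.sum_comm]
          simp_rw [Finset.sum_mul]
      _ = _ := by
          simp_rw [hA, ite_mul, zero_mul]
          simp
  have h3 (z : ℂ) : ((‖z‖ : ℂ)) ^ 2 = z * star z := (Complex.mul_conj' z).symm
  push_cast
  simp_rw [h3, Finset.sum_neg_distrib, mul_div_assoc, ← mul_div_assoc, ← Finset.sum_div, h2]

/-! ### Isotropic Gaussian vectors and their projections -/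

/-- The law of a vector of length `n` with independent `CN(0, s)` entries. -/
abbrev gaussVec (n : ℕ) (s : ℝ≥0) : Measure (Fin n → ℂ) :=
  Measure.pi fun _ => circGaussian s

/-- Resampling one coordinate of a random vector with independent entries does not change its
law. -/
lemma lintegral_pi_update {ι : Type*} [Fintype ι] [DecidableEq ι] {X : ι → Type*}
    [∀ i, MeasurableSpace (X i)] (μ : ∀ i, Measure (X i)) [∀ i, IsProbabilityMeasure (μ i)]
    {F : (∀ i, X i) → ENNReal} (hF : Measurable F) (j : ι) :
    ∫⁻ x, F x ∂Measure.pi μ =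
      ∫⁻ x, ∫⁻ y, F (Function.update x j y) ∂μ j ∂Measure.pi μ := by
  have hne : ∀ i, Nonempty (X i) := fun i => (μ i).nonempty_of_neZero
  let x₀ : ∀ i, X i := fun i => (hne i).some
  have hG : Measurable fun x => ∫⁻ y, F (Function.update x j y) ∂μ j := by
    have := hF.lmarginal μ (s := {j})
    simpa only [lmarginal_singleton] using this
  rw [lintegral_eq_lmarginal_univ x₀, lintegral_eq_lmarginal_univ x₀,
    lmarginal_erase' _ hF (Finset.mem_univ j), lmarginal_erase' _ hG (Finset.mem_univ j)]
  simp

/-- The coordinates of an isotropic Gaussian vector in an orthonormal family are independent with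
the same law. -/
lemma map_inner_gaussVec {n : ℕ} (s : ℝ≥0) {ι : Type*} [Fintype ι]
    {b : ι → EuclideanSpace ℂ (Fin n)} (hb : Orthonormal ℂ b) :
    (gaussVec n s).map (fun x i => inner ℂ (b i) (WithLp.toLp 2 x)) =
      Measure.pi fun _ : ι => circGaussian s := by
  classical
  have h := map_linear_eq_pi_circGaussian (P := gaussVec n s)
    (Z := fun (m : Fin n) (x : Fin n → ℂ) => x m)
    (iIndepFun_pi (X := fun _ z => z) fun _ => aemeasurable_id) (fun m => measurable_pi_apply m)
    (fun _ => s) (fun m => (measurePreserving_eval _ m).map_eq)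
    (fun (i : ι) m => star (b i m)) (fun _ => s) (fun i j => by
      rw [← Finset.mul_sum]
      have := (orthonormal_iff_ite.mp hb) i j
      simp only [PiLp.inner_apply, RCLike.inner_apply, ← starRingEnd_apply] at this ⊢
      simp only [starRingEnd_self_apply]
      simp_rw [mul_comm ((starRingEnd ℂ) (b i _))]
      rw [this]
      split_ifs <;> simp)
  rw [← h]
  congr 1
  ext x i
  simp [PiLp.inner_apply, mul_comm]

lemma lintegral_exp_neg_mul {T : ℝ} (hT : 0 < T) :
    ∫⁻ u in Set.Ioi (0 : ℝ), ENNReal.ofReal (Real.exp (-u * T)) = ENNReal.ofReal (1 / T) := by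
  have hi : IntegrableOn (fun u : ℝ => Real.exp (-u * T)) (Set.Ioi 0) := by
    simpa [mul_comm] using exp_neg_integrableOn_Ioi 0 hT
  rw [← ofReal_integral_eq_lintegral_ofReal hi (ae_of_all _ fun u => (Real.exp_pos _).le)]
  congr 1
  have := integral_exp_mul_Ioi (neg_lt_zero.mpr hT) 0
  simp only [mul_zero, Real.exp_zero] at this
  simp_rw [neg_mul_comm, mul_comm _ (-T)]
  rw [this]
  ring

lemma lintegral_one_div_one_add_pow {s : ℝ} (hs : 0 < s) (n : ℕ) :
    ∫⁻ u in Set.Ioi (0 : ℝ), ENNReal.ofReal (1 / (1 + u * s)) ^ (n + 2) =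
      ENNReal.ofReal (1 / (s * (n + 1))) := by
  have hn : (0 : ℝ) < n + 1 := by positivity
  have hpos {u : ℝ} (hu : 0 ≤ u) : 0 < 1 + u * s := by positivity
  have hd (u : ℝ) (hu : u ∈ Set.Ici (0 : ℝ)) :
      HasDerivAt (fun u : ℝ => -(1 / (s * (n + 1))) * ((1 + u * s) ^ (n + 1))⁻¹)
        ((1 / (1 + u * s)) ^ (n + 2)) u := by
    have h0 := (hpos hu).ne'
    have h1 : HasDerivAt (fun u : ℝ => 1 + u * s) s u := by
      simpa using ((hasDerivAt_id u).mul_const s).const_add 1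
    refine (((h1.pow (n + 1)).inv (pow_ne_zero _ h0)).const_mul _).congr_deriv ?_
    simp only [Pi.pow_apply]
    rw [Nat.add_sub_cancel]
    push_cast
    clear h1
    generalize 1 + u * s = x at h0 ⊢
    rw [div_pow, one_pow]
    field_simp
    ring
  have ht : Filter.Tendsto (fun u : ℝ => -(1 / (s * (n + 1))) * ((1 + u * s) ^ (n + 1))⁻¹)
      Filter.atTop (nhds 0) := by
    have h1 : Filter.Tendsto (fun u : ℝ => (1 + u * s) ^ (n + 1)) Filter.atTop Filter.atTop :=
      (Filter.tendsto_pow_atTop (Nat.succ_ne_zero n)).comp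
        (Filter.tendsto_atTop_add_const_left _ _ (Filter.tendsto_id.atTop_mul_const hs))
    simpa using h1.inv_tendsto_atTop.const_mul (-(1 / (s * (n + 1))))
  have hnn (u : ℝ) (hu : u ∈ Set.Ioi (0 : ℝ)) : 0 ≤ (1 / (1 + u * s)) ^ (n + 2) := by
    have := hpos (le_of_lt hu); positivity
  have hi := integrableOn_Ioi_deriv_of_nonneg' hd hnn ht
  have hv := integral_Ioi_of_hasDerivAt_of_nonneg' hd hnn ht
  have : ∫⁻ u in Set.Ioi (0 : ℝ), ENNReal.ofReal (1 / (1 + u * s)) ^ (n + 2) =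
      ∫⁻ u in Set.Ioi (0 : ℝ), ENNReal.ofReal ((1 / (1 + u * s)) ^ (n + 2)) := by
    refine setLIntegral_congr_fun measurableSet_Ioi fun u hu => ?_
    have := hpos (le_of_lt hu)
    exact (ENNReal.ofReal_pow (by positivity) _).symm
  rw [this, ← ofReal_integral_eq_lintegral_ofReal hi
    ((ae_restrict_iff' measurableSet_Ioi).mpr (ae_of_all _ hnn)), hv]
  simp

lemma ae_sum_norm_sq_pos {ι : Type*} [Fintype ι] [Nonempty ι] {s : ℝ≥0} (hs : s ≠ 0) :
    ∀ᵐ z ∂(Measure.pi fun _ : ι => circGaussian s), 0 < ∑ i, ‖z i‖ ^ 2 := by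
  obtain ⟨i⟩ := ‹Nonempty ι›
  have h : ∀ᵐ z ∂(circGaussian s), z ≠ 0 := by
    rw [ae_iff]; simpa using circGaussian_singleton_zero hs
  filter_upwards [(measurePreserving_eval (fun _ : ι => circGaussian s) i).quasiMeasurePreserving.ae
    h] with z hz
  exact Finset.sum_pos' (fun _ _ => by positivity) ⟨i, Finset.mem_univ i, by
    have : z i ≠ 0 := hz
    positivity⟩

/-- The inverse moment of a sum of `d ≥ 2` squared moduli of independent `CN(0, s)` variables.
It is computed from the Laplace transform, as `1 / T = ∫ u in (0, ∞), exp (-u T)`. -/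
lemma lintegral_one_div_sum_norm_sq {ι : Type*} [Fintype ι] {s : ℝ≥0} (hs : s ≠ 0)
    (hd : 2 ≤ Fintype.card ι) :
    ∫⁻ z, ENNReal.ofReal (1 / ∑ i, ‖z i‖ ^ 2) ∂(Measure.pi fun _ : ι => circGaussian s) =
      ENNReal.ofReal (1 / (s * (Fintype.card ι - 1))) := by
  have : Nonempty ι := Fintype.card_pos_iff.mp (by omega)
  obtain ⟨n, hn⟩ := Nat.exists_eq_add_of_le' hd
  have hs' : (0 : ℝ) < s := by positivity
  calc ∫⁻ z, ENNReal.ofReal (1 / ∑ i, ‖z i‖ ^ 2) ∂(Measure.pi fun _ : ι => circGaussian s)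
      = ∫⁻ z, (∫⁻ u in Set.Ioi (0 : ℝ), ENNReal.ofReal (Real.exp (-u * ∑ i, ‖z i‖ ^ 2)))
          ∂(Measure.pi fun _ : ι => circGaussian s) := by
        refine lintegral_congr_ae ?_
        filter_upwards [ae_sum_norm_sq_pos hs] with z hz
        exact (lintegral_exp_neg_mul hz).symm
    _ = ∫⁻ u in Set.Ioi (0 : ℝ), (∫⁻ z, ENNReal.ofReal (Real.exp (-u * ∑ i, ‖z i‖ ^ 2))
          ∂(Measure.pi fun _ : ι => circGaussian s)) := by
        refine lintegral_lintegral_swap ?_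
        exact Measurable.aemeasurable (by fun_prop)
    _ = ∫⁻ u in Set.Ioi (0 : ℝ), ENNReal.ofReal (1 / (1 + u * s)) ^ (n + 2) := by
        refine setLIntegral_congr_fun measurableSet_Ioi fun u hu => ?_
        have h1 (z : ι → ℂ) : ENNReal.ofReal (Real.exp (-u * ∑ i, ‖z i‖ ^ 2)) =
            ∏ i, ENNReal.ofReal (Real.exp (-u * ‖z i‖ ^ 2)) := by
          rw [Finset.mul_sum, Real.exp_sum,
            ENNReal.ofReal_prod_of_nonneg fun i _ => (Real.exp_pos _).le]
        simp_rw [h1]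
        rw [lintegral_prod_eq_prod_lintegral_of_indepFun Finset.univ
          (fun i (z : ι → ℂ) => ENNReal.ofReal (Real.exp (-u * ‖z i‖ ^ 2)))
          (iIndepFun_pi (X := fun _ (z : ℂ) => ENNReal.ofReal (Real.exp (-u * ‖z‖ ^ 2)))
            fun _ => Measurable.aemeasurable (by fun_prop)) (fun i => by fun_prop)]
        have h2 (i : ι) : ∫⁻ z : ι → ℂ, ENNReal.ofReal (Real.exp (-u * ‖z i‖ ^ 2))
            ∂(Measure.pi fun _ : ι => circGaussian s) = ENNReal.ofReal (1 / (1 + u * s)) := by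
          rw [← lintegral_exp_neg_mul_norm_sq_circGaussian hs (le_of_lt hu)]
          exact (measurePreserving_eval (fun _ : ι => circGaussian s) i).lintegral_comp
            (f := fun z : ℂ => ENNReal.ofReal (Real.exp (-u * ‖z‖ ^ 2))) (by fun_prop)
        simp_rw [h2]
        rw [Finset.prod_const, Finset.card_univ, hn]
    _ = _ := by
        rw [lintegral_one_div_one_add_pow hs', hn]
        congr 3
        push_cast
        ring

/-- An isotropic Gaussian vector almost surely avoids any proper subspace. -/
lemma ae_notMem_submodule {n : ℕ} {s : ℝ≥0} (hs : s ≠ 0)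
    {V : Submodule ℂ (EuclideanSpace ℂ (Fin n))} (hV : V ≠ ⊤) :
    ∀ᵐ x ∂gaussVec n s, WithLp.toLp 2 x ∉ V := by
  -- the coordinates along an orthonormal basis of `Vᗮ` do not all vanish
  have hW : Vᗮ ≠ ⊥ := fun h => hV ((Submodule.orthogonal_eq_bot_iff).mp h)
  let b := stdOrthonormalBasis ℂ Vᗮ
  have hb : Orthonormal ℂ fun i => ((b i : Vᗮ) : EuclideanSpace ℂ (Fin n)) :=
    b.orthonormal.comp_linearIsometry Vᗮ.subtypeₗᵢ
  have hpos : 0 < Module.finrank ℂ Vᗮ :=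
    Nat.pos_of_ne_zero fun h => hW (Submodule.finrank_eq_zero.mp h)
  have : Nonempty (Fin (Module.finrank ℂ Vᗮ)) := ⟨⟨0, hpos⟩⟩
  have h := ae_sum_norm_sq_pos (ι := Fin (Module.finrank ℂ Vᗮ)) hs
  rw [← map_inner_gaussVec s hb] at h
  filter_upwards [ae_of_ae_map (Measurable.aemeasurable (by fun_prop)) h] with x hx hxV
  refine hx.ne' (Finset.sum_eq_zero fun i _ => ?_)
  rw [Submodule.inner_left_of_mem_orthogonal hxV (b i).2]
  simp

/-- The inverse squared length of the projection of an isotropic Gaussian vector onto a subspace has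
a mean that depends on the dimension of the subspace only. -/
lemma lintegral_one_div_norm_sq_starProjection {n : ℕ} {s : ℝ≥0} (hs : s ≠ 0)
    (W : Submodule ℂ (EuclideanSpace ℂ (Fin n))) (hW : 2 ≤ Module.finrank ℂ W) :
    ∫⁻ x, ENNReal.ofReal (1 / ‖W.starProjection (WithLp.toLp 2 x)‖ ^ 2) ∂gaussVec n s =
      ENNReal.ofReal (1 / (s * (Module.finrank ℂ W - 1))) := by
  let b := stdOrthonormalBasis ℂ W
  have hb : Orthonormal ℂ fun i => ((b i : W) : EuclideanSpace ℂ (Fin n)) :=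
    b.orthonormal.comp_linearIsometry W.subtypeₗᵢ
  have h := lintegral_one_div_sum_norm_sq (ι := Fin (Module.finrank ℂ W)) hs (by simpa using hW)
  rw [← map_inner_gaussVec s hb, lintegral_map (by fun_prop) (by fun_prop)] at h
  rw [Fintype.card_fin] at h
  rw [← h]
  refine lintegral_congr fun x => ?_
  congr 2
  have h1 := b.sum_sq_norm_inner_right (W.orthogonalProjectionOnto (WithLp.toLp 2 x))
  rw [Submodule.starProjection_apply, ← Submodule.coe_norm, ← h1]
  refine Finset.sum_congr rfl fun i _ => ?_
  congr 2
  rw [Submodule.inner_orthogonalProjectionOnto_eq_of_mem_left]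

/-! ### Gaussian matrices with independent columns -/

lemma measurable_matrix_det {α n : Type*} [MeasurableSpace α] [Fintype n] [DecidableEq n]
    {f : α → Matrix n n ℂ} (hf : ∀ i j, Measurable fun x => f x i j) :
    Measurable fun x => (f x).det := by
  simp_rw [Matrix.det_apply]
  exact Finset.measurable_fun_sum _ fun σ _ =>
    (Finset.measurable_fun_prod _ fun i _ => hf _ _).const_smul _

lemma measurable_matrix_inv_apply {α n : Type*} [MeasurableSpace α] [Fintype n] [DecidableEq n]
    {f : α → Matrix n n ℂ} (hf : ∀ i j, Measurable fun x => f x i j) (i j : n) :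
    Measurable fun x => (f x)⁻¹ i j := by
  simp_rw [Matrix.inv_def, Ring.inverse_eq_inv', Matrix.smul_apply, smul_eq_mul,
    Matrix.adjugate_apply]
  refine (measurable_matrix_det hf).inv.mul (measurable_matrix_det fun a b => ?_)
  by_cases h : a = j
  · subst h; simp
  · simpa [Matrix.updateRow_ne h] using hf a b

lemma measurable_matrix_mul_apply {α m n p : Type*} [MeasurableSpace α] [Fintype n]
    {f : α → Matrix m n ℂ} {g : α → Matrix n p ℂ} (hf : ∀ i j, Measurable fun x => f x i j)
    (hg : ∀ i j, Measurable fun x => g x i j) (i : m) (j : p) :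
    Measurable fun x => (f x * g x) i j := by
  simp_rw [Matrix.mul_apply]
  fun_prop

lemma measurable_matrix_conjTranspose_apply {α m n : Type*} [MeasurableSpace α]
    {f : α → Matrix m n ℂ} (hf : ∀ i j, Measurable fun x => f x i j) (i : n) (j : m) :
    Measurable fun x => (f x)ᴴ i j := by
  simp_rw [Matrix.conjTranspose_apply]
  exact continuous_star.measurable.comp (hf j i)

/-- The zero-forcing direction `H (Hᴴ H)⁻¹ e_j` of the `j`-th column of `H`. -/
def zfDir {M r : ℕ} (H : Matrix (Fin M) (Fin r) ℂ) (j : Fin r) : Fin M → ℂ :=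
  (H * (Hᴴ * H)⁻¹) *ᵥ Pi.single j 1

/-- The matrix with prescribed columns. -/
def ofCols {M r : ℕ} (x : Fin r → Fin M → ℂ) : Matrix (Fin M) (Fin r) ℂ :=
  Matrix.of fun m j => x j m

lemma measurable_zfDir_apply {α : Type*} [MeasurableSpace α] {M r : ℕ}
    {f : α → Matrix (Fin M) (Fin r) ℂ} (hf : ∀ i j, Measurable fun x => f x i j)
    (j : Fin r) (m : Fin M) : Measurable fun x => zfDir (f x) j m := by
  simp_rw [zfDir, Matrix.mulVec_single_one, Matrix.col_apply]
  exact measurable_matrix_mul_apply hf (measurable_matrix_inv_apply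
    (measurable_matrix_mul_apply (measurable_matrix_conjTranspose_apply hf) hf)) _ _

lemma normSq_eq_norm_sq {n : ℕ} (v : Fin n → ℂ) : normSq v = ‖WithLp.toLp 2 v‖ ^ 2 :=
  (EuclideanSpace.norm_sq_eq _).symm

lemma normSq_nonneg {n : ℕ} (v : Fin n → ℂ) : 0 ≤ normSq v :=
  Finset.sum_nonneg fun _ _ => by positivity

lemma normSq_smul {n : ℕ} (c : ℝ) (v : Fin n → ℂ) : normSq ((c : ℂ) • v) = c ^ 2 * normSq v := by
  simp [normSq, mul_pow, Finset.mul_sum]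

lemma measurable_normSq {α : Type*} [MeasurableSpace α] {n : ℕ} {f : α → Fin n → ℂ}
    (hf : ∀ m, Measurable fun x => f x m) : Measurable fun x => normSq (f x) := by
  unfold normSq
  fun_prop

open scoped ComplexOrder in
lemma isUnit_det_of_linearIndependent {M r : ℕ} {x : Fin r → Fin M → ℂ}
    (hx : LinearIndependent ℂ fun j => (WithLp.toLp 2 (x j) : EuclideanSpace ℂ (Fin M))) :
    IsUnit ((ofCols x)ᴴ * ofCols x).det := by
  have h1 : LinearIndependent ℂ (ofCols x).col := by
    have := hx.map' (WithLp.linearEquiv 2 ℂ (Fin M → ℂ)).toLinearMap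
      (LinearEquiv.ker _)
    exact this
  have h2 : Function.Injective (ofCols x).mulVec := Matrix.mulVec_injective_iff.mpr h1
  exact (Matrix.isUnit_iff_isUnit_det _).mp (Matrix.PosDef.conjTranspose_mul_self _ h2).isUnit

/-- The zero-forcing direction of a column is its component orthogonal to the other columns,
divided by the squared length of that component. -/
lemma normSq_zfDir {M r : ℕ} {x : Fin r → Fin M → ℂ} (j : Fin r)
    (hx : LinearIndependent ℂ fun j => (WithLp.toLp 2 (x j) : EuclideanSpace ℂ (Fin M)))
    {V : Submodule ℂ (EuclideanSpace ℂ (Fin M))}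
    (hV : V = Submodule.span ℂ ((fun i => WithLp.toLp 2 (x i)) '' {j}ᶜ)) :
    normSq (zfDir (ofCols x) j) = 1 / ‖Vᗮ.starProjection (WithLp.toLp 2 (x j))‖ ^ 2 := by
  set H := ofCols x with hH
  set e : Fin r → EuclideanSpace ℂ (Fin M) := fun i => WithLp.toLp 2 (x i) with he
  set q := Vᗮ.starProjection (e j) with hq
  have hqV : q ∈ Vᗮ := Submodule.starProjection_apply_mem _ _
  have hsub : e j - q ∈ V := by
    rw [hq, Submodule.starProjection_orthogonal_val, sub_sub_cancel]
    exact Submodule.starProjection_apply_mem _ _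
  have hq0 : q ≠ 0 := by
    intro h0
    rw [h0, sub_zero, hV] at hsub
    have := linearIndependent_iff_notMem_span.mp hx j
    apply this
    rwa [← Set.compl_eq_univ_sdiff]
  have hspan : q ∈ Submodule.span ℂ (Set.range e) := by
    have h1 : e j - q ∈ Submodule.span ℂ (Set.range e) :=
      Submodule.span_mono (Set.image_subset_range _ _) (hV ▸ hsub)
    have h2 : e j ∈ Submodule.span ℂ (Set.range e) := Submodule.subset_span ⟨j, rfl⟩
    simpa using Submodule.sub_mem _ h2 h1
  -- `q` is a combination `H a` of the columns with `Hᴴ q = ‖q‖² e_j`, so `a = ‖q‖² (Hᴴ H)⁻¹ e_j`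
  obtain ⟨a, ha⟩ := (Submodule.mem_span_range_iff_exists_fun ℂ).mp hspan
  have ha' : H *ᵥ a = WithLp.ofLp q := by
    ext m
    rw [← ha]
    simp [Matrix.mulVec, dotProduct, hH, ofCols, he, mul_comm]
  have hin (i : Fin r) : inner ℂ (e i) q = if i = j then ((‖q‖ : ℂ)) ^ 2 else 0 := by
    split_ifs with hij
    · subst hij
      have h1 : inner ℂ (e i - q) q = 0 := Submodule.inner_right_of_mem_orthogonal hsub hqV
      rw [inner_sub_left, sub_eq_zero] at h1
      rw [h1, inner_self_eq_norm_sq_to_K]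
      rfl
    · refine Submodule.inner_right_of_mem_orthogonal (K := V) ?_ hqV
      rw [hV]
      exact Submodule.subset_span ⟨i, hij, rfl⟩
  have hHq : Hᴴ *ᵥ (WithLp.ofLp q) = ((‖q‖ : ℂ) ^ 2) • Pi.single j 1 := by
    ext i
    have h1 := hin i
    rw [PiLp.inner_apply] at h1
    simp only [RCLike.inner_apply] at h1
    simp only [Matrix.mulVec, dotProduct, Matrix.conjTranspose_apply, Pi.smul_apply,
      Pi.single_apply, smul_eq_mul, mul_ite, mul_one, mul_zero]
    rw [← h1]
    exact Finset.sum_congr rfl fun m _ => mul_comm _ _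
  have hdet := isUnit_det_of_linearIndependent hx
  have hz : WithLp.ofLp q = ((‖q‖ : ℂ) ^ 2) • zfDir H j := by
    have h1 : a = (Hᴴ * H)⁻¹ *ᵥ (((‖q‖ : ℂ) ^ 2) • Pi.single j 1) := by
      rw [← hHq, ← ha', Matrix.mulVec_mulVec, Matrix.mulVec_mulVec, Matrix.mul_assoc,
        Matrix.nonsing_inv_mul _ hdet, Matrix.one_mulVec]
    rw [← ha', h1, zfDir, ← Matrix.mulVec_smul, Matrix.mulVec_mulVec]
  have hn : ‖q‖ ≠ 0 := norm_ne_zero_iff.mpr hq0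
  have h2 : ‖q‖ = ‖q‖ ^ 2 * ‖WithLp.toLp 2 (zfDir H j)‖ := by
    have h3 : q = ((‖q‖ : ℂ) ^ 2) • WithLp.toLp 2 (zfDir H j) := by
      rw [← WithLp.toLp_smul, ← hz]
    nth_rewrite 1 [h3]
    rw [norm_smul]
    simp
  rw [normSq_eq_norm_sq]
  field_simp
  have h4 : ‖q‖ * ‖WithLp.toLp 2 (zfDir H j)‖ = 1 := by
    apply mul_left_cancel₀ hn
    linarith
  rw [← mul_pow, mul_comm, h4, one_pow]

lemma measurableSet_linearIndepOn {M r : ℕ} (T : Finset (Fin r)) :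
    MeasurableSet {x : Fin r → Fin M → ℂ |
      LinearIndepOn ℂ (fun j => (WithLp.toLp 2 (x j) : EuclideanSpace ℂ (Fin M))) T} := by
  have h : IsOpen {f : T → EuclideanSpace ℂ (Fin M) | LinearIndependent ℂ f} :=
    isOpen_setOfPred_linearIndependent
  have hc : Continuous fun (x : Fin r → Fin M → ℂ) (i : T) =>
      (WithLp.toLp 2 (x i) : EuclideanSpace ℂ (Fin M)) := by
    fun_prop
  exact (h.preimage hc).measurableSet

/-- The columns of a Gaussian matrix which is not wider than tall are almost surely linearly
independent. -/
lemma ae_linearIndependent_pi_gaussVec {M r : ℕ} (hr : r ≤ M) {s : Fin r → ℝ≥0}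
    (hs : ∀ j, s j ≠ 0) :
    ∀ᵐ x ∂(Measure.pi fun j => gaussVec M (s j)),
      LinearIndependent ℂ fun j => (WithLp.toLp 2 (x j) : EuclideanSpace ℂ (Fin M)) := by
  suffices h : ∀ T : Finset (Fin r), ∀ᵐ x ∂(Measure.pi fun j => gaussVec M (s j)),
      LinearIndepOn ℂ (fun j => (WithLp.toLp 2 (x j) : EuclideanSpace ℂ (Fin M))) T by
    simpa [linearIndepOn_univ_iff] using h Finset.univ
  intro T
  induction T using Finset.induction_on with
  | empty => simp
  | insert j T hj ih =>
    have hmeas := (measurableSet_linearIndepOn (M := M) (insert j T)).compl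
    refine (mem_ae_iff (s := {x : Fin r → Fin M → ℂ | LinearIndepOn ℂ (fun j =>
      (WithLp.toLp 2 (x j) : EuclideanSpace ℂ (Fin M))) ↑(insert j T)})).mpr ?_
    rw [← lintegral_indicator_one hmeas,
      lintegral_pi_update _ (measurable_one.indicator hmeas) j]
    refine (lintegral_congr_ae ?_).trans lintegral_zero
    -- given independent columns in `T`, the resampled column `j` avoids their span
    filter_upwards [ih] with x hx
    set V : Submodule ℂ (EuclideanSpace ℂ (Fin M)) := Submodule.span ℂ
      ((fun i => (WithLp.toLp 2 (x i) : EuclideanSpace ℂ (Fin M))) '' T) with hV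
    have hVtop : V ≠ ⊤ := by
      intro h
      have h1 : Module.finrank ℂ V ≤ T.card := by
        rw [hV, ← Finset.coe_image]
        exact (finrank_span_finset_le_card _).trans Finset.card_image_le
      rw [h, finrank_top, finrank_euclideanSpace, Fintype.card_fin] at h1
      have h2 : T.card < r := by
        simpa using Finset.card_lt_univ_of_notMem hj
      omega
    refine (lintegral_congr_ae ?_).trans lintegral_zero
    filter_upwards [ae_notMem_submodule (hs j) hVtop] with y hy
    have hcongr : ∀ i ∈ (T : Set (Fin r)), (fun i => (WithLp.toLp 2 (Function.update x j y i) :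
        EuclideanSpace ℂ (Fin M))) i = WithLp.toLp 2 (x i) := fun i hi => by
      have : i ≠ j := fun h => hj (h ▸ hi)
      simp [Function.update_of_ne this]
    have hLI : LinearIndepOn ℂ (fun i => (WithLp.toLp 2 (Function.update x j y i) :
        EuclideanSpace ℂ (Fin M))) ↑(insert j T) := by
      rw [Finset.coe_insert, linearIndepOn_insert (by simpa using hj),
        linearIndepOn_congr hcongr, Set.image_congr hcongr]
      exact ⟨hx, by simpa using hy⟩
    have hmem : Function.update x j y ∈ {x : Fin r → Fin M → ℂ | LinearIndepOn ℂ (fun j =>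
      (WithLp.toLp 2 (x j) : EuclideanSpace ℂ (Fin M))) ↑(insert j T)} := hLI
    exact Set.indicator_of_notMem (Set.notMem_compl_iff.mpr hmem) _

/-- The squared length of a zero-forcing direction of a Gaussian matrix with independent columns
`CN(0, s j I)` has mean `1 / ((M - r) s j)`: given the other columns, it is the inverse squared
distance of the `j`-th column to an `r - 1` dimensional subspace. -/
theorem lintegral_normSq_zfDir_pi {M r : ℕ} (hr : r < M) {s : Fin r → ℝ≥0}
    (hs : ∀ j, s j ≠ 0) (j : Fin r) :
    ∫⁻ x, ENNReal.ofReal (normSq (zfDir (ofCols x) j)) ∂(Measure.pi fun j => gaussVec M (s j)) =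
      ENNReal.ofReal (1 / (s j * ((M : ℝ) - r))) := by
  have hm : Measurable fun x : Fin r → Fin M → ℂ =>
      ENNReal.ofReal (normSq (zfDir (ofCols x) j)) := by
    refine (measurable_normSq fun m => measurable_zfDir_apply (fun a b => ?_) _ _).ennreal_ofReal
    simp only [ofCols, Matrix.of_apply]
    fun_prop
  rw [lintegral_pi_update _ hm j]
  suffices h : ∀ᵐ x ∂(Measure.pi fun j => gaussVec M (s j)),
      ∫⁻ y, ENNReal.ofReal (normSq (zfDir (ofCols (Function.update x j y)) j)) ∂gaussVec M (s j) =
        ENNReal.ofReal (1 / (s j * ((M : ℝ) - r))) by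
    rw [lintegral_congr_ae h]
    simp
  filter_upwards [ae_linearIndependent_pi_gaussVec hr.le hs] with x hx
  set V : Submodule ℂ (EuclideanSpace ℂ (Fin M)) := Submodule.span ℂ
    ((fun i => (WithLp.toLp 2 (x i) : EuclideanSpace ℂ (Fin M))) '' {j}ᶜ) with hV
  have hVr : Module.finrank ℂ V = r - 1 := by
    have h1 : LinearIndependent ℂ fun i : ({j}ᶜ : Set (Fin r)) =>
        (WithLp.toLp 2 (x i) : EuclideanSpace ℂ (Fin M)) :=
      hx.comp _ Subtype.val_injective
    have h2 := finrank_span_eq_card h1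
    rw [hV, Set.image_eq_range, h2, Fintype.card_compl_set]
    simp
  have hr0 : 0 < r := j.pos
  have hW : Module.finrank ℂ Vᗮ = M - r + 1 := by
    have := V.finrank_add_finrank_orthogonal
    rw [hVr, finrank_euclideanSpace, Fintype.card_fin] at this
    omega
  have hVtop : V ≠ ⊤ := by
    intro h
    rw [h, finrank_top, finrank_euclideanSpace, Fintype.card_fin] at hVr
    omega
  have key := lintegral_one_div_norm_sq_starProjection (hs j) Vᗮ (by omega)
  rw [hW] at key
  convert key using 1
  · refine lintegral_congr_ae ?_
    filter_upwards [ae_notMem_submodule (hs j) hVtop] with y hy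
    have hcongr : ∀ i ∈ ({j}ᶜ : Set (Fin r)), (fun i => (WithLp.toLp 2 (Function.update x j y i) :
        EuclideanSpace ℂ (Fin M))) i = WithLp.toLp 2 (x i) := fun i hi => by
      have : i ≠ j := hi
      simp [Function.update_of_ne this]
    have hLI : LinearIndependent ℂ fun i => (WithLp.toLp 2 (Function.update x j y i) :
        EuclideanSpace ℂ (Fin M)) := by
      have hu : (Set.univ : Set (Fin r)) = insert j {j}ᶜ := by
        ext i; simp [em]
      rw [← linearIndepOn_univ_iff, hu, linearIndepOn_insert (by simp),
        linearIndepOn_congr hcongr, Set.image_congr hcongr]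
      exact ⟨hx.comp _ Subtype.val_injective, by simpa using hy⟩
    rw [normSq_zfDir j hLI (V := V) (by rw [Set.image_congr hcongr])]
    simp
  · congr 3
    rw [Nat.cast_add, Nat.cast_sub hr.le]
    simp

/-! ### Second moments of white vectors against independent vectors -/

/-- Circularly symmetric Gaussian entries that are independent form a white vector. -/
lemma integral_mul_star_of_indep {Ω ι : Type*} [DecidableEq ι] [MeasurableSpace Ω] {P : Measure Ω}
    {X : ι → Ω → ℂ} (hX : iIndepFun X P) (hXm : ∀ i, Measurable (X i)) {q : ι → ℝ≥0}
    (hlaw : ∀ i, P.map (X i) = circGaussian (q i)) (a b : ι) :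
    ∫ ω, X a ω * star (X b ω) ∂P = if a = b then (q a : ℂ) else 0 := by
  split_ifs with h
  · subst h
    have h1 (ω : Ω) : X a ω * star (X a ω) = ((‖X a ω‖ ^ 2 : ℝ) : ℂ) := by
      rw [Complex.ofReal_pow]; exact Complex.mul_conj' _
    simp_rw [h1]
    rw [integral_complex_ofReal, ← integral_norm_sq_circGaussian, ← hlaw a,
      integral_map (hXm a).aemeasurable (Continuous.aestronglyMeasurable (by fun_prop))]
  · have h1 : IndepFun (X a) (fun ω => star (X b ω)) P :=
      (hX.indepFun h).comp measurable_id continuous_star.measurable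
    rw [h1.integral_fun_mul_eq_mul_integral (hXm a).aestronglyMeasurable
      (continuous_star.measurable.comp (hXm b)).aestronglyMeasurable]
    have h2 : ∫ ω, X a ω ∂P = 0 := by
      rw [← integral_id_circGaussian (q a), ← hlaw a,
        integral_map (hXm a).aemeasurable (Continuous.aestronglyMeasurable (by fun_prop))]
    rw [h2, zero_mul]

lemma memLp_of_map_eq_circGaussian {Ω : Type*} [MeasurableSpace Ω] {P : Measure Ω}
    {X : Ω → ℂ} (hXm : Measurable X) {q : ℝ≥0} (hlaw : P.map X = circGaussian q) :
    MemLp X 2 P :=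
  (memLp_id_circGaussian q).comp_measurePreserving ⟨hXm, hlaw⟩

lemma integral_eq_zero_of_map_eq_circGaussian {Ω : Type*} [MeasurableSpace Ω] {P : Measure Ω}
    {X : Ω → ℂ} (hXm : Measurable X) {q : ℝ≥0} (hlaw : P.map X = circGaussian q) :
    ∫ ω, X ω ∂P = 0 := by
  rw [← integral_id_circGaussian q, ← hlaw,
    integral_map hXm.aemeasurable (Continuous.aestronglyMeasurable (by fun_prop))]

/-- `e` is a white vector with variance `q`: centered, square integrable, and with covariance
matrix `q I`. -/
structure IsWhite {Ω : Type*} [MeasurableSpace Ω] {M : ℕ} (e : Ω → Fin M → ℂ) (q : ℝ)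
    (P : Measure Ω) : Prop where
  memLp : ∀ a, MemLp (fun ω => e ω a) 2 P
  integral_eq_zero : ∀ a, ∫ ω, e ω a ∂P = 0
  integral_mul_star : ∀ a b, ∫ ω, e ω a * star (e ω b) ∂P = if a = b then (q : ℂ) else 0

section White

variable {Ω : Type*} [MeasurableSpace Ω] {P : Measure Ω} {M : ℕ}
  {e w : Ω → Fin M → ℂ} {Y : Ω → ℂ} {q : ℝ}

lemma memLp_star {X : Ω → ℂ} (hX : MemLp X 2 P) : MemLp (fun ω => star (X ω)) 2 P :=
  hX.congr_norm (continuous_star.comp_aestronglyMeasurable hX.1) (by simp)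

lemma integrable_mul_star_of_memLp {X Y : Ω → ℂ} (hX : MemLp X 2 P) (hY : MemLp Y 2 P) :
    Integrable (fun ω => X ω * star (Y ω)) P :=
  MemLp.integrable_mul hX (memLp_star hY)

lemma integrable_normSq (hw : ∀ a, MemLp (fun ω => w ω a) 2 P) :
    Integrable (fun ω => normSq (w ω)) P := by
  unfold normSq
  exact integrable_finsetSum _ fun a _ => (hw a).integrable_norm_pow two_ne_zero

lemma IsWhite.memLp_dotProduct [IsProbabilityMeasure P] (he : IsWhite e q P)
    (hw : ∀ a, MemLp (fun ω => w ω a) 2 P) (hind : IndepFun e w P) :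
    MemLp (fun ω => star (e ω) ⬝ᵥ w ω) 2 P := by
  unfold dotProduct
  refine memLp_finsetSum _ fun a _ => ?_
  have hm : AEStronglyMeasurable (fun ω => star (e ω) a * w ω a) P :=
    (memLp_star (he.memLp a)).1.mul (hw a).1
  rw [memLp_two_iff_integrable_sq_norm hm]
  have h1 : IndepFun (fun ω => ‖e ω a‖ ^ 2) (fun ω => ‖w ω a‖ ^ 2) P :=
    hind.comp (φ := fun x : Fin M → ℂ => ‖x a‖ ^ 2) (ψ := fun x : Fin M → ℂ => ‖x a‖ ^ 2)
      (by fun_prop) (by fun_prop)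
  refine (h1.integrable_mul ((he.memLp a).integrable_norm_pow two_ne_zero)
    ((hw a).integrable_norm_pow two_ne_zero)).congr (ae_of_all _ fun ω => ?_)
  simp [mul_pow]

lemma IsWhite.integral_dotProduct (he : IsWhite e q P) (hint : ∀ a, Integrable (fun ω => w ω a) P)
    [IsProbabilityMeasure P] (hind : IndepFun e w P) :
    ∫ ω, star (e ω) ⬝ᵥ w ω ∂P = 0 := by
  have h1 (a : Fin M) : IndepFun (fun ω => star (e ω a)) (fun ω => w ω a) P :=
    hind.comp (φ := fun x : Fin M → ℂ => star (x a)) (ψ := fun x : Fin M → ℂ => x a)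
      (continuous_star.measurable.comp (measurable_pi_apply a)) (by fun_prop)
  have h2 (a : Fin M) : Integrable (fun ω => star (e ω a)) P :=
    (memLp_star (he.memLp a)).integrable one_le_two
  have hi (a : Fin M) : Integrable (fun ω => star (e ω a) * w ω a) P :=
    (h1 a).integrable_mul (h2 a) (hint a)
  simp only [dotProduct, Pi.star_apply]
  rw [integral_finsetSum _ fun a _ => hi a]
  refine Finset.sum_eq_zero fun a _ => ?_
  rw [(h1 a).integral_fun_mul_eq_mul_integral (h2 a).1 (hint a).1]
  have h3 : ∫ ω, star (e ω a) ∂P = star (∫ ω, e ω a ∂P) := integral_conj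
  rw [h3, he.integral_eq_zero]
  simp

/-- The inner product with an independent white vector of variance `q` has mean square
`q E‖w‖²`, and is uncorrelated with everything independent of the white vector. -/
lemma IsWhite.integral_norm_sq_dotProduct_add [IsProbabilityMeasure P] (he : IsWhite e q P)
    (hw : ∀ a, MemLp (fun ω => w ω a) 2 P) (hY : MemLp Y 2 P)
    (hind : IndepFun e (fun ω => (w ω, Y ω)) P) :
    ∫ ω, ‖star (e ω) ⬝ᵥ w ω + Y ω‖ ^ 2 ∂P =
      q * ∫ ω, normSq (w ω) ∂P + ∫ ω, ‖Y ω‖ ^ 2 ∂P := by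
  have hindw : IndepFun e w P := hind.comp measurable_id measurable_fst
  have hX := he.memLp_dotProduct hw hindw
  have hsq (z : ℂ) : ((‖z‖ ^ 2 : ℝ) : ℂ) = z * star z := by
    rw [Complex.ofReal_pow]; exact (Complex.mul_conj' z).symm
  -- the mean square of the inner product
  have hXX : ∫ ω, ‖star (e ω) ⬝ᵥ w ω‖ ^ 2 ∂P = q * ∫ ω, normSq (w ω) ∂P := by
    apply Complex.ofReal_injective
    have hindab (a b : Fin M) : IndepFun (fun ω => e ω b * star (e ω a))
        (fun ω => w ω a * star (w ω b)) P :=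
      hindw.comp (φ := fun x : Fin M → ℂ => x b * star (x a))
        (ψ := fun x : Fin M → ℂ => x a * star (x b))
        (Continuous.measurable (by fun_prop)) (Continuous.measurable (by fun_prop))
    have hexp (ω : Ω) : ((‖star (e ω) ⬝ᵥ w ω‖ ^ 2 : ℝ) : ℂ) =
        ∑ a, ∑ b, (e ω b * star (e ω a)) * (w ω a * star (w ω b)) := by
      rw [hsq]
      simp only [dotProduct, Pi.star_apply, star_sum, star_mul', star_star]
      rw [Finset.sum_mul_sum]
      refine Finset.sum_congr rfl fun a _ => Finset.sum_congr rfl fun b _ => ?_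
      ring
    have hi (a b : Fin M) : Integrable
        (fun ω => (e ω b * star (e ω a)) * (w ω a * star (w ω b))) P :=
      (hindab a b).integrable_mul (integrable_mul_star_of_memLp (he.memLp b) (he.memLp a))
        (integrable_mul_star_of_memLp (hw a) (hw b))
    rw [← integral_complex_ofReal]
    simp_rw [hexp]
    rw [integral_finsetSum _ fun a _ => integrable_finsetSum _ fun b _ => hi a b]
    have hval (a : Fin M) : ∫ ω, ∑ b, (e ω b * star (e ω a)) * (w ω a * star (w ω b)) ∂P =
        q * ∫ ω, ((‖w ω a‖ ^ 2 : ℝ) : ℂ) ∂P := by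
      rw [integral_finsetSum _ fun b _ => hi a b]
      have hterm (b : Fin M) : ∫ ω, (e ω b * star (e ω a)) * (w ω a * star (w ω b)) ∂P =
          if b = a then q * ∫ ω, ((‖w ω a‖ ^ 2 : ℝ) : ℂ) ∂P else 0 := by
        rw [(hindab a b).integral_fun_mul_eq_mul_integral
          (integrable_mul_star_of_memLp (he.memLp b) (he.memLp a)).1
          (integrable_mul_star_of_memLp (hw a) (hw b)).1, he.integral_mul_star]
        split_ifs with hab
        · subst hab
          simp_rw [hsq]
        · rw [zero_mul]
      simp_rw [hterm]
      simp
    simp_rw [hval, ← Finset.mul_sum, integral_complex_ofReal]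
    unfold normSq
    rw [integral_finsetSum _ fun a _ => (hw a).integrable_norm_pow two_ne_zero]
    push_cast
    rfl
  -- the cross term
  have hXY : ∫ ω, (star (e ω) ⬝ᵥ w ω) * star (Y ω) ∂P = 0 := by
    have h1 (ω : Ω) : (star (e ω) ⬝ᵥ w ω) * star (Y ω) =
        star (e ω) ⬝ᵥ fun a => w ω a * star (Y ω) := by
      simp [dotProduct, Finset.sum_mul, mul_assoc]
    simp_rw [h1]
    refine he.integral_dotProduct (fun a => integrable_mul_star_of_memLp (hw a) hY) ?_
    exact hind.comp (φ := id) (ψ := fun p : (Fin M → ℂ) × ℂ => fun a => p.1 a * star p.2)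
      measurable_id (Continuous.measurable (by fun_prop))
  have hcross : ∫ ω, ((star (e ω) ⬝ᵥ w ω) * star (Y ω)).re ∂P = 0 := by
    have := integral_re (𝕜 := ℂ) (integrable_mul_star_of_memLp hX hY)
    simp only [RCLike.re_to_complex] at this
    rw [this, hXY, Complex.zero_re]
  have hpt (ω : Ω) : ‖star (e ω) ⬝ᵥ w ω + Y ω‖ ^ 2 = ‖star (e ω) ⬝ᵥ w ω‖ ^ 2 + ‖Y ω‖ ^ 2
      + 2 * ((star (e ω) ⬝ᵥ w ω) * star (Y ω)).re := by
    rw [← Complex.normSq_eq_norm_sq, Complex.normSq_add, Complex.normSq_eq_norm_sq,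
      Complex.normSq_eq_norm_sq]
    rfl
  have hre : Integrable (fun ω => 2 * ((star (e ω) ⬝ᵥ w ω) * star (Y ω)).re) P :=
    (integrable_mul_star_of_memLp hX hY).re.const_mul 2
  simp_rw [hpt]
  have hX2 : Integrable (fun ω => ‖star (e ω) ⬝ᵥ w ω‖ ^ 2) P :=
    hX.integrable_norm_pow two_ne_zero
  have hY2 : Integrable (fun ω => ‖Y ω‖ ^ 2) P := hY.integrable_norm_pow two_ne_zero
  have hXY2 : Integrable (fun ω => ‖star (e ω) ⬝ᵥ w ω‖ ^ 2 + ‖Y ω‖ ^ 2) P := hX2.add hY2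
  rw [integral_add hXY2 hre, integral_add hX2 hY2, hXX, integral_const_mul, hcross]
  ring

end White

/-! ### The projection onto the orthogonal complement of the columns of a matrix -/

/-- The matrix `I - H (Hᴴ H)⁻¹ Hᴴ`. If `Hᴴ H` is singular, Mathlib's inverse is `0` and this is
the identity. -/
def projCompl {M r : ℕ} (H : Matrix (Fin M) (Fin r) ℂ) : Matrix (Fin M) (Fin M) ℂ :=
  1 - H * (Hᴴ * H)⁻¹ * Hᴴ

section Proj

variable {M r : ℕ} (H : Matrix (Fin M) (Fin r) ℂ)

lemma conjTranspose_projCompl : (projCompl H)ᴴ = projCompl H := by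
  simp [projCompl, Matrix.conjTranspose_nonsing_inv, Matrix.mul_assoc]

lemma conjTranspose_mul_projCompl {H : Matrix (Fin M) (Fin r) ℂ} (h : IsUnit (Hᴴ * H).det) :
    Hᴴ * projCompl H = 0 := by
  rw [projCompl, Matrix.mul_sub, Matrix.mul_one, ← Matrix.mul_assoc, ← Matrix.mul_assoc,
    Matrix.mul_nonsing_inv _ h, Matrix.one_mul, sub_self]

lemma projCompl_mul_self : projCompl H * projCompl H = projCompl H := by
  by_cases h : IsUnit (Hᴴ * H).det
  · nth_rewrite 1 [projCompl]
    rw [Matrix.sub_mul, Matrix.one_mul, Matrix.mul_assoc (H * _), conjTranspose_mul_projCompl h,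
      Matrix.mul_zero, sub_zero]
  · simp [projCompl, Matrix.nonsing_inv_apply_not_isUnit _ h]

lemma sum_norm_sq_projCompl (m : Fin M) :
    ((∑ a, ‖projCompl H m a‖ ^ 2 : ℝ) : ℂ) = projCompl H m m := by
  have h : projCompl H * (projCompl H)ᴴ = projCompl H := by
    rw [conjTranspose_projCompl, projCompl_mul_self]
  nth_rewrite 2 [← h]
  rw [Matrix.mul_apply]
  push_cast
  exact Finset.sum_congr rfl fun a _ => (Complex.mul_conj' _).symm

lemma norm_projCompl_apply_le (m a : Fin M) : ‖projCompl H m a‖ ≤ 1 := by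
  have h1 : ∑ a, ‖projCompl H m a‖ ^ 2 = ‖projCompl H m m‖ := by
    rw [← sum_norm_sq_projCompl, Complex.norm_real, Real.norm_of_nonneg (by positivity)]
  -- the diagonal entry dominates its own square, hence is at most `1`
  have h2 (a : Fin M) : ‖projCompl H m a‖ ^ 2 ≤ ‖projCompl H m m‖ := by
    rw [← h1]
    exact Finset.single_le_sum (f := fun a => ‖projCompl H m a‖ ^ 2)
      (fun _ _ => by positivity) (Finset.mem_univ a)
  have h3 : ‖projCompl H m m‖ ≤ 1 := by
    by_contra! h
    nlinarith [h2 m]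
  have h4 := (h2 a).trans h3
  rwa [sq_le_one_iff₀ (norm_nonneg _)] at h4

lemma projCompl_ne_zero (hr : r < M) : projCompl H ≠ 0 := by
  intro h
  have h1 : (1 : Matrix (Fin M) (Fin M) ℂ) = H * ((Hᴴ * H)⁻¹ * Hᴴ) := by
    rw [← Matrix.mul_assoc]
    exact sub_eq_zero.mp h
  have h2 := Matrix.rank_mul_le_left H ((Hᴴ * H)⁻¹ * Hᴴ)
  rw [← h1, Matrix.rank_one, Fintype.card_fin] at h2
  have h3 := H.rank_le_width
  omega

lemma measurable_projCompl_apply {α : Type*} [MeasurableSpace α]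
    {f : α → Matrix (Fin M) (Fin r) ℂ} (hf : ∀ i j, Measurable fun x => f x i j)
    (m a : Fin M) : Measurable fun x => projCompl (f x) m a := by
  have hH := measurable_matrix_conjTranspose_apply hf
  simp_rw [projCompl, Matrix.sub_apply]
  exact measurable_const.sub (measurable_matrix_mul_apply (measurable_matrix_mul_apply hf
    (measurable_matrix_inv_apply (measurable_matrix_mul_apply hH hf))) hH _ _)

lemma conjTranspose_mulVec_zfDir {H : Matrix (Fin M) (Fin r) ℂ} (h : IsUnit (Hᴴ * H).det)
    (j : Fin r) : Hᴴ *ᵥ zfDir H j = Pi.single j 1 := by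
  rw [zfDir, Matrix.mulVec_mulVec, ← Matrix.mul_assoc, Matrix.mul_nonsing_inv _ h,
    Matrix.one_mulVec]

end Proj

lemma memLp_projCompl_mulVec {Ω : Type*} [MeasurableSpace Ω] {P : Measure Ω} {M r : ℕ}
    {f : Ω → Matrix (Fin M) (Fin r) ℂ} (hf : ∀ i j, Measurable fun x => f x i j)
    {v : Ω → Fin M → ℂ} (hv : ∀ a, MemLp (fun ω => v ω a) 2 P) (m : Fin M) :
    MemLp (fun ω => (projCompl (f ω) *ᵥ v ω) m) 2 P := by
  simp only [Matrix.mulVec, dotProduct]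
  refine memLp_finsetSum _ fun a _ => ?_
  refine (hv a).of_le ((measurable_projCompl_apply hf m a).aestronglyMeasurable.mul (hv a).1)
    (ae_of_all _ fun ω => ?_)
  rw [norm_mul]
  exact mul_le_of_le_one_left (norm_nonneg _) (norm_projCompl_apply_le _ _ _)

lemma measurable_ofCols_apply {M r : ℕ} (i : Fin M) (j : Fin r) :
    Measurable fun x : Fin r → Fin M → ℂ => ofCols x i j := by
  simp only [ofCols, Matrix.of_apply]
  fun_prop

/-- A white vector of positive variance, even after a shift by a constant vector, does not vanish
under an independent projection onto the complement of fewer than `M` columns. -/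
lemma integral_normSq_projCompl_mulVec_pos {Ω : Type*} [MeasurableSpace Ω] {P : Measure Ω}
    [IsProbabilityMeasure P] {M r : ℕ} (hr : r < M) {x : Ω → Fin r → Fin M → ℂ}
    (hx : Measurable x) {e : Ω → Fin M → ℂ} {q : ℝ} (hq : 0 < q)
    (he : IsWhite e q P) (hind : IndepFun e x P) (b : Fin M → ℂ) :
    0 < ∫ ω, normSq (projCompl (ofCols (x ω)) *ᵥ (e ω + b)) ∂P := by
  have hf (i : Fin M) (j : Fin r) : Measurable fun ω => ofCols (x ω) i j :=
    (measurable_ofCols_apply i j).comp hx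
  have hBm (m a : Fin M) : Measurable fun x : Fin r → Fin M → ℂ => projCompl (ofCols x) m a :=
    measurable_projCompl_apply measurable_ofCols_apply m a
  have hB (m a : Fin M) : MemLp (fun ω => projCompl (ofCols (x ω)) m a) 2 P :=
    MemLp.of_bound (measurable_projCompl_apply hf m a).aestronglyMeasurable 1
      (ae_of_all _ fun ω => norm_projCompl_apply_le _ _ _)
  have hv (m : Fin M) : MemLp (fun ω => (projCompl (ofCols (x ω)) *ᵥ (e ω + b)) m) 2 P :=
    memLp_projCompl_mulVec hf (v := fun ω => e ω + b)
      (fun a => (he.memLp a).add (memLp_const (b a))) m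
  have hrow (m : Fin M) : q * ∫ ω, normSq (projCompl (ofCols (x ω)) m) ∂P ≤
      ∫ ω, ‖(projCompl (ofCols (x ω)) *ᵥ (e ω + b)) m‖ ^ 2 ∂P := by
    have hY : MemLp (fun ω => star ((projCompl (ofCols (x ω)) *ᵥ b) m)) 2 P :=
      memLp_star (memLp_projCompl_mulVec hf (v := fun _ => b) (fun a => memLp_const _) m)
    have hi : IndepFun e (fun ω => ((fun a => star (projCompl (ofCols (x ω)) m a)),
        star ((projCompl (ofCols (x ω)) *ᵥ b) m))) P := by
      refine hind.comp (φ := id) (ψ := fun x : Fin r → Fin M → ℂ =>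
        ((fun a => star (projCompl (ofCols x) m a)), star ((projCompl (ofCols x) *ᵥ b) m)))
        measurable_id ?_
      refine Measurable.prodMk (measurable_pi_lambda _ fun a =>
        continuous_star.measurable.comp (hBm m a)) (continuous_star.measurable.comp ?_)
      simp only [Matrix.mulVec, dotProduct]
      exact Finset.measurable_fun_sum _ fun a _ => (hBm m a).mul_const _
    have h := he.integral_norm_sq_dotProduct_add
      (w := fun ω a => star (projCompl (ofCols (x ω)) m a))
      (fun a => memLp_star (hB m a)) hY hi
    have h1 (ω : Ω) : ‖(star (e ω) ⬝ᵥ fun a => star (projCompl (ofCols (x ω)) m a)) +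
        star ((projCompl (ofCols (x ω)) *ᵥ b) m)‖ =
          ‖(projCompl (ofCols (x ω)) *ᵥ (e ω + b)) m‖ := by
      rw [← norm_star]
      congr 1
      simp [Matrix.mulVec, dotProduct, add_mul, Finset.sum_add_distrib, mul_comm]
    have h2 (ω : Ω) : normSq (fun a => star (projCompl (ofCols (x ω)) m a)) =
        normSq (projCompl (ofCols (x ω)) m) := by
      simp [normSq]
    simp_rw [h1, h2] at h
    rw [h]
    exact le_add_of_nonneg_right (integral_nonneg fun _ => by positivity)
  have hsum : q * ∫ ω, ∑ m, normSq (projCompl (ofCols (x ω)) m) ∂P ≤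
      ∫ ω, normSq (projCompl (ofCols (x ω)) *ᵥ (e ω + b)) ∂P := by
    have h1 : ∫ ω, normSq (projCompl (ofCols (x ω)) *ᵥ (e ω + b)) ∂P =
        ∑ m, ∫ ω, ‖(projCompl (ofCols (x ω)) *ᵥ (e ω + b)) m‖ ^ 2 ∂P :=
      integral_finsetSum _ fun m _ => (hv m).integrable_norm_pow two_ne_zero
    rw [h1, integral_finsetSum _ fun m _ => integrable_normSq (hB m), Finset.mul_sum]
    exact Finset.sum_le_sum fun m _ => hrow m
  refine lt_of_lt_of_le (mul_pos hq ?_) hsum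
  have hnn (ω : Ω) : 0 < ∑ m, normSq (projCompl (ofCols (x ω)) m) := by
    have h0 := projCompl_ne_zero (ofCols (x ω)) hr
    generalize projCompl (ofCols (x ω)) = B at h0
    have hnn' (m : Fin M) : 0 ≤ normSq (B m) := by unfold normSq; positivity
    refine (Finset.sum_nonneg fun m _ => hnn' m).lt_of_ne' fun h => h0 ?_
    ext m a
    have h1 := (Finset.sum_eq_zero_iff_of_nonneg fun m _ => hnn' m).mp h m (Finset.mem_univ m)
    have h2 := (Finset.sum_eq_zero_iff_of_nonneg fun a _ => by positivity).mp h1 a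
      (Finset.mem_univ a)
    simpa using h2
  rw [integral_pos_iff_support_of_nonneg (fun ω => (hnn ω).le)
    (integrable_finsetSum _ fun m _ => integrable_normSq (hB m))]
  have : Function.support (fun ω => ∑ m, normSq (projCompl (ofCols (x ω)) m)) = Set.univ :=
    Set.eq_univ_of_forall fun ω => (hnn ω).ne'
  rw [this]
  simp

/-! ### Row-wise linear images of a Gaussian array -/

section Rows

variable {Ω : Type*} [MeasurableSpace Ω] {P : Measure Ω}

lemma map_prod_curry {M : ℕ} {R : Type*} [Fintype R] {X : R → Ω → Fin M → ℂ}
    (hXm : ∀ r m, Measurable fun ω => X r ω m) (w : R → ℝ≥0)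
    (h : P.map (fun ω (p : R × Fin M) => X p.1 ω p.2) =
      Measure.pi fun p => circGaussian (w p.1)) :
    P.map (fun ω r => X r ω) = Measure.pi fun r => gaussVec M (w r) := by
  have h1 := Measure.infinitePi_map_curry (fun (r : R) (_ : Fin M) => circGaussian (w r))
  simp only [Measure.infinitePi_eq_pi] at h1
  rw [← h1, ← h, Measure.map_map (by fun_prop) (by fun_prop)]
  rfl

lemma isWhite_of_map_eq_gaussVec [IsProbabilityMeasure P] {M : ℕ} {X : Ω → Fin M → ℂ}
    (hXm : ∀ m, Measurable fun ω => X ω m) {q : ℝ≥0} (h : P.map X = gaussVec M q) :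
    IsWhite X q P := by
  change P.map X = Measure.pi fun _ => circGaussian q at h
  have hlaw (m : Fin M) : P.map (fun ω => X ω m) = circGaussian q := by
    rw [← (measurePreserving_eval (fun _ : Fin M => circGaussian q) m).map_eq, ← h,
      Measure.map_map (by fun_prop) (by fun_prop)]
    rfl
  have hind : iIndepFun (fun m ω => X ω m) P := by
    rw [iIndepFun_iff_map_fun_eq_pi_map fun m => (hXm m).aemeasurable]
    simp_rw [hlaw]
    exact h
  exact ⟨fun a => memLp_of_map_eq_circGaussian (hXm a) (hlaw a),
    fun a => integral_eq_zero_of_map_eq_circGaussian (hXm a) (hlaw a),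
    fun a b => integral_mul_star_of_indep hind hXm hlaw a b⟩

/-- If every row of an array of independent Gaussians is multiplied by the same matrix with
orthogonal rows, then the columns of the resulting array are independent isotropic Gaussian
vectors. -/
theorem map_rowwise_eq_pi_gaussVec [IsProbabilityMeasure P] {M : ℕ} {J R : Type*} [Fintype J]
    [Fintype R] [DecidableEq R]
    {Z : Fin M × J → Ω → ℂ} (hZ : iIndepFun Z P) (hZm : ∀ i, Measurable (Z i)) (v : J → ℝ≥0)
    (hlaw : ∀ i, P.map (Z i) = circGaussian (v i.2)) (a : R → J → ℂ) (w : R → ℝ≥0)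
    (ha : ∀ r r', ∑ i, (v i : ℂ) * (a r i * star (a r' i)) = if r = r' then (w r : ℂ) else 0) :
    P.map (fun ω r m => ∑ i, a r i * Z (m, i) ω) = Measure.pi fun r => gaussVec M (w r) := by
  refine map_prod_curry (X := fun r ω m => ∑ i, a r i * Z (m, i) ω) (fun r m => by fun_prop) w ?_
  have h := map_linear_eq_pi_circGaussian hZ hZm (fun i => v i.2) hlaw
    (fun (p : R × Fin M) i => if i.1 = p.2 then a p.1 i.2 else 0) (fun p => w p.1) ?_
  · rw [← h]
    congr 1
    ext ω p
    simp [Fintype.sum_prod_type_right]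
  · rintro ⟨r, m⟩ ⟨r', m'⟩
    rw [Fintype.sum_prod_type]
    by_cases hm : m = m'
    · subst hm
      rw [Finset.sum_eq_single m (fun m' _ hm' => by simp [hm']) (by simp)]
      simpa using ha r r'
    · simp only [Prod.mk.injEq, hm, and_false, if_false]
      refine Finset.sum_eq_zero fun m'' _ => Finset.sum_eq_zero fun i _ => ?_
      by_cases h1 : m'' = m
      · subst h1; simp [hm]
      · simp [h1]

end Rows

/-! ### The channel estimates as row-wise linear images -/

namespace Params

variable {M N KI KE τI τE : ℕ} (S : Params M N KI KE τI τE)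

/-- The random quantities at one antenna: the IU fading, the BS-RIS fading and the noise. -/
abbrev RowIdx (N KI τI τE : ℕ) : Type := Fin KI ⊕ Fin N ⊕ Fin (τI + τE)

/-- The variances of the random quantities at one antenna. -/
def rowVar : RowIdx N KI τI τE → ℝ≥0
  | Sum.inl _ => 1
  | Sum.inr (Sum.inl _) => 1
  | Sum.inr (Sum.inr _) => S.noiseVar

/-- The coefficients of the channel of IU `k`. -/
def coefH (k : Fin KI) : RowIdx N KI τI τE → ℂ
  | Sum.inl k' => if k' = k then (Real.sqrt (S.betaBI k) : ℂ) else 0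
  | Sum.inr _ => 0

/-- The coefficients of the received signal projected onto the `j`-th IU pilot. -/
def coefI (j : Fin τI) : RowIdx N KI τI τE → ℂ
  | Sum.inl k => if S.iI k = j then (Real.sqrt S.tauP : ℂ) * Real.sqrt (S.betaBI k) else 0
  | Sum.inr (Sum.inl _) => 0
  | Sum.inr (Sum.inr s) => S.PhiI s j

/-- The coefficients of the estimation error `h_k - c_k y_k` of IU `k`. -/
def coefErr (k : Fin KI) (i : RowIdx N KI τI τE) : ℂ :=
  S.coefH k i - (S.cH k : ℂ) * S.coefI (S.iI k) i

/-- The gain of the scattered BS-RIS path through the `n`-th RIS element towards EU `l`. -/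
def gainE (l : Fin KE) (n : Fin N) : ℂ :=
  (Real.sqrt (S.beta / (S.delta + 1)) : ℂ) * Complex.exp (Complex.I * (S.psi n : ℂ)) *
    ((Real.sqrt (S.betaRE l) : ℂ) * S.fbar l n)

/-- The coefficients of the centered received signal projected onto the pilot of EU `l`. -/
def coefE (l : Fin KE) : RowIdx N KI τI τE → ℂ
  | Sum.inl _ => 0
  | Sum.inr (Sum.inl n) =>
      (Real.sqrt S.tauP : ℂ) * ∑ l', if S.iE l' = S.iE l then S.gainE l' n else 0
  | Sum.inr (Sum.inr s) => S.PhiE s (S.iE l)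

/-- The variance of the received signal projected onto the `j`-th IU pilot. -/
def colVar (j : Fin τI) : ℝ :=
  S.tauP * (∑ k, if S.iI k = j then S.betaBI k else 0) + S.noiseVar

/-- The variance of the received signal projected onto the pilot of EU `l`. -/
def euVar (l : Fin KE) : ℝ :=
  (∑ n, ‖S.coefE l (Sum.inr (Sum.inl n))‖ ^ 2) + S.noiseVar

lemma tauP_nonneg : 0 ≤ S.tauP := mul_nonneg (Nat.cast_nonneg _) S.p_pos.le

lemma tauP_pos_of_eu (l : Fin KE) : 0 < S.tauP := by
  have := (S.iE l).pos
  exact mul_pos (by exact_mod_cast (by omega)) S.p_pos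

lemma noiseVar_real_pos : (0 : ℝ) < S.noiseVar := S.noiseVar_pos

lemma colVar_pos (j : Fin τI) : 0 < S.colVar j :=
  add_pos_of_nonneg_of_pos (mul_nonneg S.tauP_nonneg (Finset.sum_nonneg fun k _ => by
    split_ifs; exacts [(S.betaBI_pos k).le, le_rfl])) S.noiseVar_real_pos

lemma euVar_pos (l : Fin KE) : 0 < S.euVar l :=
  add_pos_of_nonneg_of_pos (Finset.sum_nonneg fun _ _ => by positivity) S.noiseVar_real_pos

lemma tauP_mul_betaBI_le_colVar (k : Fin KI) : S.tauP * S.betaBI k ≤ S.colVar (S.iI k) := by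
  have h : S.betaBI k ≤ ∑ k', if S.iI k' = S.iI k then S.betaBI k' else 0 := by
    have := Finset.single_le_sum (f := fun k' => if S.iI k' = S.iI k then S.betaBI k' else 0)
      (fun k' _ => by split_ifs; exacts [(S.betaBI_pos k').le, le_rfl])
      (Finset.mem_univ k)
    simpa using this
  have h1 := mul_le_mul_of_nonneg_left h S.tauP_nonneg
  have h2 := S.noiseVar_real_pos
  unfold colVar
  linarith

lemma sum_PhiI_star (j j' : Fin τI) :
    ∑ s, star (S.PhiI s j) * S.PhiI s j' = if j = j' then 1 else 0 := by
  have := congrFun (congrFun S.PhiI_orthonormal j) j'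
  simpa [Matrix.mul_apply, Matrix.one_apply] using this

lemma sum_PhiE_star (j j' : Fin τE) :
    ∑ s, star (S.PhiE s j) * S.PhiE s j' = if j = j' then 1 else 0 := by
  have := congrFun (congrFun S.PhiE_orthonormal j) j'
  simpa [Matrix.mul_apply, Matrix.one_apply] using this

lemma sum_PhiI_star_PhiE (j : Fin τI) (j' : Fin τE) :
    ∑ s, star (S.PhiI s j) * S.PhiE s j' = 0 := by
  have := congrFun (congrFun S.Phi_orthogonal j) j'
  simpa [Matrix.mul_apply] using this

lemma sum_PhiE_star_PhiI (j : Fin τE) (j' : Fin τI) :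
    ∑ s, star (S.PhiE s j) * S.PhiI s j' = 0 := by
  have := congrArg star (S.sum_PhiI_star_PhiE j' j)
  simpa [star_sum, mul_comm] using this

lemma pilotI_dotProduct (k k' : Fin KI) :
    star (S.pilotI k) ⬝ᵥ S.pilotI k' = if S.iI k = S.iI k' then 1 else 0 :=
  S.sum_PhiI_star _ _

lemma pilotE_dotProduct_pilotI (l : Fin KE) (k : Fin KI) :
    star (S.pilotE l) ⬝ᵥ S.pilotI k = 0 :=
  S.sum_PhiE_star_PhiI _ _

lemma cH_eq (k : Fin KI) : S.cH k = Real.sqrt S.tauP * S.betaBI k / S.colVar (S.iI k) := by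
  have h (k' : Fin KI) : S.betaBI k' * ‖(if S.iI k' = S.iI k then 1 else 0 : ℂ)‖ ^ 2 =
      if S.iI k' = S.iI k then S.betaBI k' else 0 := by
    split_ifs <;> simp
  unfold cH colVar
  simp_rw [pilotI_dotProduct, pilotE_dotProduct_pilotI, h]
  simp

lemma gammaH_eq (k : Fin KI) : S.gammaH k = S.tauP * S.betaBI k ^ 2 / S.colVar (S.iI k) := by
  rw [gammaH, cH_eq]
  have h := Real.mul_self_sqrt S.tauP_nonneg
  rw [← mul_div_assoc]
  congr 1
  nth_rewrite 3 [← h]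
  ring

lemma gammaH_eq_sq (k : Fin KI) : S.gammaH k = S.cH k ^ 2 * S.colVar (S.iI k) := by
  have h := (S.colVar_pos (S.iI k)).ne'
  rw [gammaH_eq, cH_eq, div_pow, mul_pow, Real.sq_sqrt S.tauP_nonneg]
  field_simp

lemma cG_pos (hN : 0 < N) (l : Fin KE) : 0 < S.cG l := by
  have hl (l : Fin KE) : 0 < S.lam l :=
    div_pos (mul_pos (S.betaRE_pos l) S.beta_pos) (by linarith [S.delta_nonneg])
  have hN' : (0 : ℝ) < N := by exact_mod_cast hN
  refine div_pos (mul_pos (Real.sqrt_pos.mpr (S.tauP_pos_of_eu l)) (mul_pos hN' (hl l)))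
    (add_pos_of_nonneg_of_pos (mul_nonneg S.tauP_nonneg (add_nonneg ?_ ?_)) S.noiseVar_real_pos)
  · exact Finset.sum_nonneg fun l' _ => mul_nonneg (mul_nonneg hN'.le (hl l').le) (sq_nonneg _)
  · exact Finset.sum_nonneg fun k _ => mul_nonneg (S.betaBI_pos k).le (sq_nonneg _)

lemma errVar_nonneg (k : Fin KI) : 0 ≤ S.betaBI k - S.gammaH k := by
  have h := S.colVar_pos (S.iI k)
  rw [gammaH_eq, sub_nonneg, div_le_iff₀ h]
  have := mul_le_mul_of_nonneg_left (S.tauP_mul_betaBI_le_colVar k) (S.betaBI_pos k).le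
  linarith

/-- The inner product of coefficient vectors that gives the covariance of the signals at one
antenna. -/
def covIp (a b : RowIdx N KI τI τE → ℂ) : ℂ := ∑ i, (S.rowVar i : ℂ) * (a i * star (b i))

lemma covIp_star (a b : RowIdx N KI τI τE → ℂ) : star (S.covIp a b) = S.covIp b a := by
  simp only [covIp, star_sum, star_mul', star_star]
  refine Finset.sum_congr rfl fun i _ => ?_
  have : star (S.rowVar i : ℂ) = (S.rowVar i : ℂ) := Complex.conj_ofReal _
  rw [this, mul_comm (b i)]

lemma covIp_eq (a b : RowIdx N KI τI τE → ℂ) : S.covIp a b =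
    ∑ k, a (Sum.inl k) * star (b (Sum.inl k)) +
      (∑ n, a (Sum.inr (Sum.inl n)) * star (b (Sum.inr (Sum.inl n))) +
        S.noiseVar * ∑ s, a (Sum.inr (Sum.inr s)) * star (b (Sum.inr (Sum.inr s)))) := by
  simp [covIp, Fintype.sum_sum_type, rowVar, Finset.mul_sum]

lemma covIp_sub_mul_left (a a' b : RowIdx N KI τI τE → ℂ) (c : ℂ) :
    S.covIp (fun i => a i - c * a' i) b = S.covIp a b - c * S.covIp a' b := by
  simp only [covIp, Finset.mul_sum, ← Finset.sum_sub_distrib]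
  refine Finset.sum_congr rfl fun i _ => ?_
  ring

lemma covIp_coefH_coefH (k : Fin KI) : S.covIp (S.coefH k) (S.coefH k) = S.betaBI k := by
  rw [covIp_eq]
  simp [coefH, ← Complex.ofReal_mul, Real.mul_self_sqrt (S.betaBI_pos k).le]

lemma covIp_coefH_coefI (k : Fin KI) (j : Fin τI) : S.covIp (S.coefH k) (S.coefI j) =
    if S.iI k = j then (Real.sqrt S.tauP * S.betaBI k : ℂ) else 0 := by
  rw [covIp_eq]
  simp only [coefH, coefI, ite_mul, zero_mul, Finset.sum_ite_eq', Finset.mem_univ, if_true,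
    Finset.sum_const_zero, mul_zero, add_zero]
  split_ifs with h
  · rw [star_mul', ← starRingEnd_apply, ← starRingEnd_apply, Complex.conj_ofReal,
      Complex.conj_ofReal, mul_left_comm, ← Complex.ofReal_mul (Real.sqrt (S.betaBI k)),
      Real.mul_self_sqrt (S.betaBI_pos k).le]
  · simp

lemma covIp_coefI_coefI (j j' : Fin τI) : S.covIp (S.coefI j) (S.coefI j') =
    if j = j' then (S.colVar j : ℂ) else 0 := by
  rw [covIp_eq]
  have h1 : ∑ s, S.PhiI s j * star (S.PhiI s j') = if j = j' then 1 else 0 := by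
    have h2 := S.sum_PhiI_star j' j
    simp_rw [eq_comm (a := j')] at h2
    rw [← h2]
    exact Finset.sum_congr rfl fun s _ => mul_comm _ _
  simp only [coefI, h1, zero_mul, Finset.sum_const_zero, zero_add]
  split_ifs with h
  · subst h
    unfold colVar
    push_cast
    rw [mul_one, Finset.mul_sum]
    congr 1
    refine Finset.sum_congr rfl fun k _ => ?_
    split_ifs
    · rw [star_mul', ← starRingEnd_apply, ← starRingEnd_apply, Complex.conj_ofReal,
        Complex.conj_ofReal, mul_mul_mul_comm, ← Complex.ofReal_mul, ← Complex.ofReal_mul,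
        Real.mul_self_sqrt (S.betaBI_pos k).le, Real.mul_self_sqrt S.tauP_nonneg]
    · simp
  · rw [mul_zero, add_zero]
    refine Finset.sum_eq_zero fun k _ => ?_
    by_cases h2 : S.iI k = j
    · rw [if_neg (fun h3 : S.iI k = j' => h (h2.symm.trans h3))]
      simp
    · simp [h2]

lemma covIp_coefE_coefI (l : Fin KE) (j : Fin τI) : S.covIp (S.coefE l) (S.coefI j) = 0 := by
  rw [covIp_eq]
  have h1 : ∑ s, S.PhiE s (S.iE l) * star (S.PhiI s j) = 0 := by
    rw [← S.sum_PhiI_star_PhiE j (S.iE l)]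
    exact Finset.sum_congr rfl fun s _ => mul_comm _ _
  simp only [coefE, coefI, h1]
  simp

lemma covIp_coefH_coefE (k : Fin KI) (l : Fin KE) : S.covIp (S.coefH k) (S.coefE l) = 0 := by
  rw [covIp_eq]
  simp [coefE, coefH]

lemma covIp_coefE_coefE (l : Fin KE) : S.covIp (S.coefE l) (S.coefE l) = S.euVar l := by
  rw [covIp_eq, euVar]
  have h1 : ∑ s, S.PhiE s (S.iE l) * star (S.PhiE s (S.iE l)) = 1 := by
    have := S.sum_PhiE_star (S.iE l) (S.iE l)
    rw [if_pos rfl] at this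
    rw [← this]
    exact Finset.sum_congr rfl fun s _ => mul_comm _ _
  have h2 (z : ℂ) : z * star z = (‖z‖ : ℂ) ^ 2 := Complex.mul_conj' z
  simp_rw [h2] at h1 ⊢
  simp only [coefE, h1]
  simp

/-- The estimation error is uncorrelated with the signals from which the IU channels are
estimated. -/
lemma covIp_coefErr_coefI (k : Fin KI) (j : Fin τI) :
    S.covIp (S.coefErr k) (S.coefI j) = 0 := by
  unfold coefErr
  rw [covIp_sub_mul_left, covIp_coefH_coefI, covIp_coefI_coefI]
  split_ifs
  · rw [← Complex.ofReal_mul, ← Complex.ofReal_mul, ← Complex.ofReal_sub, cH_eq,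
      div_mul_cancel₀ _ (S.colVar_pos _).ne', sub_self, Complex.ofReal_zero]
  · simp

lemma covIp_coefErr_coefE (k : Fin KI) (l : Fin KE) :
    S.covIp (S.coefErr k) (S.coefE l) = 0 := by
  unfold coefErr
  rw [covIp_sub_mul_left, covIp_coefH_coefE, ← S.covIp_star (S.coefE l), covIp_coefE_coefI]
  simp

lemma covIp_coefErr_coefErr (k : Fin KI) :
    S.covIp (S.coefErr k) (S.coefErr k) = (S.betaBI k - S.gammaH k : ℝ) := by
  have h : S.covIp (S.coefErr k) (S.coefErr k) =
      S.covIp (S.coefH k) (S.coefErr k) - S.cH k * S.covIp (S.coefI (S.iI k)) (S.coefErr k) :=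
    S.covIp_sub_mul_left _ _ _ _
  have h1 : S.covIp (S.coefErr k) (S.coefH k) = (S.betaBI k - S.gammaH k : ℝ) := by
    have h2 : S.covIp (S.coefErr k) (S.coefH k) =
      S.covIp (S.coefH k) (S.coefH k) - S.cH k * S.covIp (S.coefI (S.iI k)) (S.coefH k) :=
      S.covIp_sub_mul_left _ _ _ _
    rw [h2, covIp_coefH_coefH, ← S.covIp_star (S.coefH k), covIp_coefH_coefI, if_pos rfl, gammaH,
      ← Complex.ofReal_mul, ← starRingEnd_apply, Complex.conj_ofReal]
    push_cast
    ring
  rw [h, ← S.covIp_star _ (S.coefI _), covIp_coefErr_coefI, ← S.covIp_star _ (S.coefH k), h1,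
    ← starRingEnd_apply, Complex.conj_ofReal]
  simp

end Params

/-- A member of an independent family is independent of all the others together. -/
lemma _root_.ProbabilityTheory.iIndepFun.indepFun_ne {Ω R E : Type*} [MeasurableSpace Ω]
    {P : Measure Ω} [Fintype R] [DecidableEq R] [MeasurableSpace E] {X : R → Ω → E}
    (hX : iIndepFun X P) (hXm : ∀ r, Measurable (X r)) (r₀ : R) :
    IndepFun (X r₀) (fun ω (r : {r // r ≠ r₀}) => X r ω) P := by
  have h := hX.indepFun_finset {r₀} {r₀}ᶜ disjoint_compl_right hXm
  have h1 : Measurable fun F : ({r₀} : Finset R) → E => F ⟨r₀, by simp⟩ := measurable_pi_apply _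
  have h2 : Measurable fun (F : ({r₀}ᶜ : Finset R) → E) (r : {r // r ≠ r₀}) =>
      F ⟨r, by simpa using r.2⟩ := measurable_pi_lambda _ fun _ => measurable_pi_apply _
  exact h.comp h1 h2

namespace Fading

variable {M N KI KE τI τE : ℕ} {S : Params M N KI KE τI τE}
  {Ω : Type*} [MeasurableSpace Ω] {P : Measure Ω} (C : Fading S P)

/-- All primitive random quantities, arranged by antenna. -/
def cell : Fin M × Params.RowIdx N KI τI τE → Ω → ℂ
  | (m, Sum.inl k) => fun ω => C.H1tilde ω m k
  | (m, Sum.inr (Sum.inl n)) => fun ω => C.H2tilde ω m n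
  | (m, Sum.inr (Sum.inr s)) => fun ω => C.noise ω m s

lemma measurable_cell (p : Fin M × Params.RowIdx N KI τI τE) : Measurable (C.cell p) := by
  rcases p with ⟨m, k | n | s⟩
  exacts [C.H1tilde_meas m k, C.H2tilde_meas m n, C.noise_meas m s]

lemma map_cell (p : Fin M × Params.RowIdx N KI τI τE) :
    P.map (C.cell p) = circGaussian (S.rowVar p.2) := by
  rcases p with ⟨m, k | n | s⟩
  exacts [C.H1tilde_law m k, C.H2tilde_law m n, C.noise_law m s]

lemma iIndepFun_cell : iIndepFun C.cell P := by
  let φ : Fin M × Params.RowIdx N KI τI τE →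
      (Fin M × Fin KI) ⊕ (Fin M × Fin N) ⊕ (Fin M × Fin (τI + τE)) := fun p =>
    match p with
    | (m, Sum.inl k) => Sum.inl (m, k)
    | (m, Sum.inr (Sum.inl n)) => Sum.inr (Sum.inl (m, n))
    | (m, Sum.inr (Sum.inr s)) => Sum.inr (Sum.inr (m, s))
  have hφ : Function.Injective φ := by
    rintro ⟨m, k | n | s⟩ ⟨m', k' | n' | s'⟩ h <;> simp_all [φ]
  have h := C.indep.precomp hφ
  convert h using 1
  funext p
  rcases p with ⟨m, k | n | s⟩ <;> rfl

/-- The random vector whose entry at each antenna is the combination of the primitive random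
quantities at that antenna with coefficients `a`. -/
def lin (a : Params.RowIdx N KI τI τE → ℂ) (ω : Ω) (m : Fin M) : ℂ :=
  ∑ i, a i * C.cell (m, i) ω

lemma measurable_lin (a : Params.RowIdx N KI τI τE → ℂ) : Measurable (C.lin a) := by
  have := C.measurable_cell
  unfold lin
  fun_prop

lemma h_eq_lin (k : Fin KI) (ω : Ω) : C.h k ω = C.lin (S.coefH k) ω := by
  ext m
  simp [h, lin, Params.coefH, Fintype.sum_sum_type, cell]

lemma Yp_apply (ω : Ω) (m : Fin M) (s : Fin (τI + τE)) : C.Yp ω m s =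
    (Real.sqrt S.tauP : ℂ) * ∑ l, C.g l ω m * star (S.pilotE l s) +
      (Real.sqrt S.tauP : ℂ) * ∑ k, C.h k ω m * star (S.pilotI k s) + C.noise ω m s := by
  simp [Yp, Matrix.sum_apply, Matrix.vecMulVec_apply]

/-- The received signal after projection onto an arbitrary vector. -/
lemma sum_Yp_mul (ω : Ω) (m : Fin M) (u : Fin (τI + τE) → ℂ) : ∑ s, C.Yp ω m s * u s =
    (Real.sqrt S.tauP : ℂ) * ∑ l, C.g l ω m * ∑ s, star (S.PhiE s (S.iE l)) * u s +
      (Real.sqrt S.tauP : ℂ) * ∑ k, C.h k ω m * ∑ s, star (S.PhiI s (S.iI k)) * u s +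
        ∑ s, C.noise ω m s * u s := by
  simp only [Yp_apply, add_mul, Finset.sum_add_distrib, Finset.mul_sum, Finset.sum_mul]
  congr 2
  · rw [Finset.sum_comm]
    refine Finset.sum_congr rfl fun l _ => Finset.sum_congr rfl fun s _ => ?_
    rw [Params.pilotE]; ring
  · rw [Finset.sum_comm]
    refine Finset.sum_congr rfl fun l _ => Finset.sum_congr rfl fun s _ => ?_
    rw [Params.pilotI]; ring

lemma H1hat_apply (ω : Ω) (m : Fin M) (j : Fin τI) :
    C.H1hat ω m j = C.lin (S.coefI j) ω m := by
  have h1 : C.H1hat ω m j = ∑ s, C.Yp ω m s * S.PhiI s j := by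
    rw [H1hat, Matrix.mul_apply]
  rw [h1, sum_Yp_mul]
  simp_rw [S.sum_PhiE_star_PhiI, S.sum_PhiI_star]
  simp only [mul_zero, Finset.sum_const_zero, zero_add, lin, Fintype.sum_sum_type, Params.coefI,
    cell, zero_mul, mul_ite, mul_one, ite_mul, Finset.mul_sum, h]
  congr 1
  · refine Finset.sum_congr rfl fun k _ => ?_
    split_ifs <;> ring
  · exact Finset.sum_congr rfl fun s _ => mul_comm _ _

lemma g_apply (l : Fin KE) (ω : Ω) (m : Fin M) : C.g l ω m =
    ∑ n, S.gainE l n * C.H2tilde ω m n +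
      ∑ n, S.gainE l n * ((Real.sqrt S.delta : ℂ) * S.H2bar m n) := by
  simp only [g, Matrix.mulVec, dotProduct, Params.Theta, Matrix.mul_diagonal, H2,
    Matrix.smul_apply, Matrix.add_apply, Pi.smul_apply, smul_eq_mul, Params.gainE]
  rw [← Finset.sum_add_distrib]
  refine Finset.sum_congr rfl fun n _ => ?_
  ring

/-- Up to a deterministic vector, the signal projected onto the pilot of EU `l` is a row-wise
combination of the primitive random quantities. -/
lemma exists_yE_eq_lin_add (l : Fin KE) :
    ∃ c : Fin M → ℂ, ∀ ω, C.yE l ω = C.lin (S.coefE l) ω + c := by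
  refine ⟨fun m => (Real.sqrt S.tauP : ℂ) * ∑ l', if S.iE l' = S.iE l then
    ∑ n, S.gainE l' n * ((Real.sqrt S.delta : ℂ) * S.H2bar m n) else 0, fun ω => ?_⟩
  ext m
  have h1 : C.yE l ω m = ∑ s, C.Yp ω m s * S.PhiE s (S.iE l) := rfl
  rw [h1, sum_Yp_mul]
  simp_rw [S.sum_PhiE_star, S.sum_PhiI_star_PhiE]
  simp only [mul_zero, Finset.sum_const_zero, add_zero, lin, Fintype.sum_sum_type, Params.coefE,
    cell, zero_mul, mul_ite, mul_one, zero_add, Pi.add_apply, g_apply]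
  have h2 : ∑ l', (if S.iE l' = S.iE l then ∑ n, S.gainE l' n * C.H2tilde ω m n +
        ∑ n, S.gainE l' n * ((Real.sqrt S.delta : ℂ) * S.H2bar m n) else 0) =
      ∑ n, (∑ l', if S.iE l' = S.iE l then S.gainE l' n else 0) * C.H2tilde ω m n +
        ∑ l', if S.iE l' = S.iE l then
          ∑ n, S.gainE l' n * ((Real.sqrt S.delta : ℂ) * S.H2bar m n) else 0 := by
    simp_rw [Finset.sum_mul]
    rw [Finset.sum_comm, ← Finset.sum_add_distrib]
    refine Finset.sum_congr rfl fun l' _ => ?_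
    split_ifs <;> simp
  rw [h2, mul_add, Finset.mul_sum]
  simp_rw [← mul_assoc, mul_comm (S.PhiE _ _)]
  ring

/-- The columns of `Ĥ₁`. -/
def cols (ω : Ω) (j : Fin τI) : Fin M → ℂ := C.lin (S.coefI j) ω

/-- The error `h_k - c_k y_k` of the channel estimate of IU `k`. -/
def err (k : Fin KI) : Ω → Fin M → ℂ := C.lin (S.coefErr k)

/-- The centered received signal projected onto the pilot of EU `l`. -/
def euSig (l : Fin KE) : Ω → Fin M → ℂ := C.lin (S.coefE l)

lemma H1hat_eq_ofCols (ω : Ω) : C.H1hat ω = ofCols (C.cols ω) := by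
  ext m j
  exact C.H1hat_apply ω m j

lemma measurable_H1hat_apply (m : Fin M) (j : Fin τI) : Measurable fun ω => C.H1hat ω m j := by
  simp_rw [H1hat_apply]
  exact (measurable_pi_apply m).comp (C.measurable_lin _)

lemma measurable_cols : Measurable C.cols :=
  measurable_pi_lambda _ fun _ => C.measurable_lin _

lemma h_eq (k : Fin KI) (ω : Ω) :
    C.h k ω = C.err k ω + (S.cH k : ℂ) • C.cols ω (S.iI k) := by
  rw [h_eq_lin]
  ext m
  simp only [err, cols, lin, Params.coefErr, Pi.add_apply, Pi.smul_apply, smul_eq_mul,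
    Finset.mul_sum, ← Finset.sum_add_distrib]
  refine Finset.sum_congr rfl fun i _ => ?_
  ring

/-! ### Independence of estimation errors and estimates -/

section Family

variable {Q : Type*} (k : Fin KI) (l : Q → Fin KE)

/-- The coefficients of the error of IU `k`, of the columns of `Ĥ₁` and of some EU signals. -/
def famCoef (S : Params M N KI KE τI τE) (k : Fin KI) (l : Q → Fin KE) :
    Unit ⊕ Fin τI ⊕ Q → Params.RowIdx N KI τI τE → ℂ :=
  Sum.elim (fun _ => S.coefErr k) (Sum.elim S.coefI fun q => S.coefE (l q))

/-- The variances that belong to `famCoef`. -/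
def famVar (S : Params M N KI KE τI τE) (k : Fin KI) (l : Q → Fin KE) :
    Unit ⊕ Fin τI ⊕ Q → ℝ≥0 :=
  Sum.elim (fun _ => ⟨S.betaBI k - S.gammaH k, S.errVar_nonneg k⟩)
    (Sum.elim (fun j => ⟨S.colVar j, (S.colVar_pos j).le⟩)
      fun q => ⟨S.euVar (l q), (S.euVar_pos (l q)).le⟩)

variable [Fintype Q] [DecidableEq Q] [Subsingleton Q] [IsProbabilityMeasure P]

/-- The error of an IU, the columns of `Ĥ₁` and the centered signal of a single EU are independent
isotropic Gaussian vectors. Signals of several EUs are excluded, as the common BS-RIS channel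
correlates them. -/
lemma map_family : P.map (fun ω r => C.lin (famCoef S k l r) ω) =
    Measure.pi fun r => gaussVec M (famVar S k l r) := by
  refine map_rowwise_eq_pi_gaussVec C.iIndepFun_cell C.measurable_cell S.rowVar C.map_cell
    (famCoef S k l) (famVar S k l) fun r r' => ?_
  change S.covIp (famCoef S k l r) (famCoef S k l r') = _
  rcases r with ⟨⟩ | j | q <;> rcases r' with ⟨⟩ | j' | q' <;>
    simp only [famCoef, famVar, Sum.elim_inl, Sum.elim_inr, reduceCtorEq, if_false, if_true]
  · exact S.covIp_coefErr_coefErr k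
  · exact S.covIp_coefErr_coefI k j'
  · exact S.covIp_coefErr_coefE k (l q')
  · rw [← S.covIp_star, S.covIp_coefErr_coefI, star_zero]
  · have h := S.covIp_coefI_coefI j j'
    by_cases hj : j = j'
    · subst hj
      rw [if_pos rfl] at h ⊢
      exact h
    · rw [if_neg hj] at h
      rw [if_neg (by simpa using hj), h]
  · simpa using (S.covIp_star (S.coefE (l q')) (S.coefI j)).symm.trans
      (by rw [S.covIp_coefE_coefI, star_zero])
  · rw [← S.covIp_star, S.covIp_coefErr_coefE, star_zero]
  · simpa using S.covIp_coefE_coefI (l q) j'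
  · obtain rfl := Subsingleton.elim q q'
    rw [if_pos rfl]
    exact S.covIp_coefE_coefE (l q)

lemma map_lin_famCoef (r : Unit ⊕ Fin τI ⊕ Q) :
    P.map (C.lin (famCoef S k l r)) = gaussVec M (famVar S k l r) := by
  rw [← (measurePreserving_eval (fun r => gaussVec M (famVar S k l r)) r).map_eq,
    ← C.map_family k l, Measure.map_map (measurable_pi_apply r)
      (measurable_pi_lambda _ fun _ => C.measurable_lin _)]
  rfl

lemma iIndepFun_family : iIndepFun (fun r => C.lin (famCoef S k l r)) P := by
  rw [iIndepFun_iff_map_fun_eq_pi_map fun r => (C.measurable_lin _).aemeasurable]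
  simp_rw [map_lin_famCoef]
  exact C.map_family k l

lemma isWhite_lin_famCoef (r : Unit ⊕ Fin τI ⊕ Q) :
    IsWhite (C.lin (famCoef S k l r)) (famVar S k l r) P :=
  isWhite_of_map_eq_gaussVec (fun m => (measurable_pi_apply m).comp (C.measurable_lin _))
    (C.map_lin_famCoef k l r)

end Family

section Independence

variable [IsProbabilityMeasure P]

lemma isWhite_err (k : Fin KI) : IsWhite (C.err k) (S.betaBI k - S.gammaH k) P :=
  C.isWhite_lin_famCoef k Empty.elim (Sum.inl ())

/-- Here `k` only witnesses that there is an information user; it selects the family in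
`map_family` from which the columns are extracted. The same holds for `isWhite_euSig` and
`map_cols`. -/
lemma isWhite_cols (k : Fin KI) (j : Fin τI) :
    IsWhite (fun ω => C.cols ω j) (S.colVar j) P :=
  C.isWhite_lin_famCoef k Empty.elim (Sum.inr (Sum.inl j))

lemma isWhite_euSig (k : Fin KI) (l : Fin KE) : IsWhite (C.euSig l) (S.euVar l) P :=
  C.isWhite_lin_famCoef k (fun _ : Unit => l) (Sum.inr (Sum.inr ()))

lemma map_cols (k : Fin KI) : P.map C.cols =
    Measure.pi fun j => gaussVec M ⟨S.colVar j, (S.colVar_pos j).le⟩ := by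
  have h := (C.iIndepFun_family k Empty.elim).precomp (g := fun j : Fin τI => Sum.inr (Sum.inl j))
    (fun a b hab => by simpa using hab)
  rw [iIndepFun_iff_map_fun_eq_pi_map fun r => (C.measurable_lin _).aemeasurable] at h
  simp_rw [map_lin_famCoef] at h
  exact h

lemma indepFun_err_cols (k : Fin KI) : IndepFun (C.err k) C.cols P := by
  have h := (C.iIndepFun_family k Empty.elim).indepFun_ne
    (fun r => C.measurable_lin _) (Sum.inl ())
  exact h.comp (ψ := fun F (j : Fin τI) => F ⟨Sum.inr (Sum.inl j), by simp⟩) measurable_id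
    (measurable_pi_lambda _ fun _ => measurable_pi_apply _)

lemma indepFun_err_cols_euSig (k : Fin KI) (l : Fin KE) :
    IndepFun (C.err k) (fun ω => (C.cols ω, C.euSig l ω)) P := by
  have h := (C.iIndepFun_family k (fun _ : Unit => l)).indepFun_ne
    (fun r => C.measurable_lin _) (Sum.inl ())
  have hψ : Measurable fun F : {r : Unit ⊕ Fin τI ⊕ Unit // r ≠ Sum.inl ()} → Fin M → ℂ =>
      ((fun j : Fin τI => F ⟨Sum.inr (Sum.inl j), by simp⟩), F ⟨Sum.inr (Sum.inr ()), by simp⟩) :=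
    (measurable_pi_lambda _ fun _ => measurable_pi_apply _).prodMk (measurable_pi_apply _)
  exact h.comp measurable_id hψ

lemma indepFun_euSig_cols (k : Fin KI) (l : Fin KE) : IndepFun (C.euSig l) C.cols P := by
  have h := (C.iIndepFun_family k (fun _ : Unit => l)).indepFun_ne
    (fun r => C.measurable_lin _) (Sum.inr (Sum.inr ()))
  exact h.comp (ψ := fun F (j : Fin τI) => F ⟨Sum.inr (Sum.inl j), by simp⟩) measurable_id
    (measurable_pi_lambda _ fun _ => measurable_pi_apply _)

end Independence

/-! ### The MMSE estimates of the IU channels -/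

section Mmse

lemma yI_eq (k : Fin KI) : C.yI k = fun ω => C.cols ω (S.iI k) := by
  funext ω m
  exact C.H1hat_apply ω m (S.iI k)

variable [IsProbabilityMeasure P]

lemma integral_err_mul_star_cols (k : Fin KI) (j : Fin τI) (m m' : Fin M) :
    ∫ ω, C.err k ω m * star (C.cols ω j m') ∂P = 0 := by
  have hind : IndepFun (fun ω => C.err k ω m) (fun ω => star (C.cols ω j m')) P :=
    (C.indepFun_err_cols k).comp (φ := fun x : Fin M → ℂ => x m)
      (ψ := fun x : Fin τI → Fin M → ℂ => star (x j m')) (by fun_prop)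
      (Continuous.measurable (by fun_prop))
  rw [hind.integral_fun_mul_eq_mul_integral ((C.isWhite_err k).memLp m).1
    (memLp_star ((C.isWhite_cols k j).memLp m')).1, (C.isWhite_err k).integral_eq_zero,
    zero_mul]

lemma hHat_eq (k : Fin KI) (ω : Ω) : C.hHat k ω = (S.cH k : ℂ) • C.cols ω (S.iI k) := by
  have he := C.isWhite_err k
  have hc := C.isWhite_cols k (S.iI k)
  have hmy : meanVec P (C.yI k) = 0 := by
    funext m
    rw [yI_eq]
    exact hc.integral_eq_zero m
  have hmh : meanVec P (C.h k) = 0 := by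
    funext m
    simp only [meanVec, h_eq, Pi.add_apply, Pi.smul_apply, smul_eq_mul]
    rw [integral_add ((he.memLp m).integrable one_le_two)
      (((hc.memLp m).integrable one_le_two).const_mul _), integral_const_mul,
      he.integral_eq_zero, hc.integral_eq_zero]
    simp
  have hyy : crossCov P (C.yI k) (C.yI k) =
      (S.colVar (S.iI k) : ℂ) • (1 : Matrix (Fin M) (Fin M) ℂ) := by
    ext m m'
    rw [crossCov, Matrix.of_apply, hmy, yI_eq, hc.integral_mul_star]
    simp [Matrix.one_apply]
  have hhy : crossCov P (C.h k) (C.yI k) =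
      ((S.cH k * S.colVar (S.iI k) : ℝ) : ℂ) • (1 : Matrix (Fin M) (Fin M) ℂ) := by
    ext m m'
    rw [crossCov, Matrix.of_apply, hmy, yI_eq]
    simp only [h_eq, Pi.add_apply, Pi.smul_apply, smul_eq_mul, add_mul, mul_assoc]
    rw [integral_add (integrable_mul_star_of_memLp (he.memLp m) (hc.memLp m'))
      ((integrable_mul_star_of_memLp (hc.memLp m) (hc.memLp m')).const_mul _), integral_const_mul,
      C.integral_err_mul_star_cols, hc.integral_mul_star]
    simp [Matrix.one_apply]
  have hs : (S.colVar (S.iI k) : ℂ) ≠ 0 := by exact_mod_cast (S.colVar_pos _).ne'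
  rw [hHat, mmse, hyy, hhy, hmy, hmh, sub_zero, add_zero]
  have hinv : ((S.colVar (S.iI k) : ℂ) • (1 : Matrix (Fin M) (Fin M) ℂ))⁻¹ =
      (S.colVar (S.iI k) : ℂ)⁻¹ • 1 := by
    refine Matrix.inv_eq_right_inv ?_
    rw [Matrix.smul_mul, Matrix.one_mul, smul_smul, mul_inv_cancel₀ hs, one_smul]
  rw [hinv, Matrix.smul_mul, Matrix.one_mul, smul_smul, Matrix.smul_mulVec, Matrix.one_mulVec,
    yI_eq]
  congr 1
  push_cast
  field_simp

lemma memLp_hHat (k : Fin KI) (m : Fin M) : MemLp (fun ω => C.hHat k ω m) 2 P := by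
  simp_rw [hHat_eq]
  exact ((C.isWhite_cols k (S.iI k)).memLp m).const_mul _

lemma integral_norm_sq_hHat (k : Fin KI) (m : Fin M) :
    ∫ ω, ‖C.hHat k ω m‖ ^ 2 ∂P = S.gammaH k := by
  simp_rw [hHat_eq]
  have h := (C.isWhite_cols k (S.iI k)).integral_mul_star m m
  rw [if_pos rfl] at h
  have h1 (z : ℂ) : z * star z = ((‖z‖ ^ 2 : ℝ) : ℂ) := by
    rw [Complex.ofReal_pow]; exact Complex.mul_conj' z
  simp_rw [h1] at h
  rw [integral_complex_ofReal] at h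
  have h2 := Complex.ofReal_injective h
  simp only [Pi.smul_apply, smul_eq_mul, norm_mul, mul_pow, Complex.norm_real, Real.norm_eq_abs,
    sq_abs]
  rw [integral_const_mul, h2, S.gammaH_eq_sq]

end Mmse

/-! ### Normalized beams that are independent of the estimation error -/

section Beam

lemma rx_smul (k : Fin KI) (c : ℂ) (w : Ω → Fin M → ℂ) :
    C.rx k (fun ω => c • w ω) = fun ω => c * C.rx k w ω := by
  funext ω
  simp [rx]

lemma integral_normSq_normalized {w : Ω → Fin M → ℂ} (hI : 0 < ∫ ω, normSq (w ω) ∂P) :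
    ∫ ω, normSq (((1 / Real.sqrt (∫ ω', normSq (w ω') ∂P) : ℝ) : ℂ) • w ω) ∂P = 1 := by
  simp_rw [normSq_smul]
  rw [integral_const_mul, div_pow, Real.sq_sqrt hI.le, one_pow, one_div_mul_cancel hI.ne']

lemma ae_rx_eq {k : Fin KI} {w : Ω → Fin M → ℂ} {y : ℂ}
    (hy : ∀ᵐ ω ∂P, ((S.cH k : ℂ) * ((C.H1hat ω)ᴴ *ᵥ w ω) (S.iI k)) = y) :
    C.rx k w =ᵐ[P] fun ω => star (C.err k ω) ⬝ᵥ w ω + y := by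
  filter_upwards [hy] with ω hω
  rw [rx, h_eq, star_add, add_dotProduct, ← hω]
  congr 1
  rw [H1hat_eq_ofCols, star_smul, smul_dotProduct]
  congr 1
  exact Complex.conj_ofReal _

variable [IsProbabilityMeasure P]

lemma memLp_rx {k : Fin KI} {w : Ω → Fin M → ℂ} (hw : ∀ m, MemLp (fun ω => w ω m) 2 P)
    (hind : IndepFun (C.err k) w P) {y : ℂ}
    (hy : ∀ᵐ ω ∂P, ((S.cH k : ℂ) * ((C.H1hat ω)ᴴ *ᵥ w ω) (S.iI k)) = y) :
    MemLp (C.rx k w) 2 P :=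
  (((C.isWhite_err k).memLp_dotProduct hw hind).add (memLp_const y)).ae_eq (C.ae_rx_eq hy).symm

lemma integral_rx {k : Fin KI} {w : Ω → Fin M → ℂ} (hw : ∀ m, MemLp (fun ω => w ω m) 2 P)
    (hind : IndepFun (C.err k) w P) {y : ℂ}
    (hy : ∀ᵐ ω ∂P, ((S.cH k : ℂ) * ((C.H1hat ω)ᴴ *ᵥ w ω) (S.iI k)) = y) :
    ∫ ω, C.rx k w ω ∂P = y := by
  have he := C.isWhite_err k
  rw [integral_congr_ae (C.ae_rx_eq hy), integral_add
    ((he.memLp_dotProduct hw hind).integrable one_le_two) (integrable_const y),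
    he.integral_dotProduct (fun m => (hw m).integrable one_le_two) hind]
  simp

/-- The received power of a beam that is independent of the estimation error splits into the
contribution of the error and that of the channel estimate. -/
lemma integral_norm_sq_rx {k : Fin KI} {w : Ω → Fin M → ℂ}
    (hw : ∀ m, MemLp (fun ω => w ω m) 2 P) (hind : IndepFun (C.err k) w P) {y : ℂ}
    (hy : ∀ᵐ ω ∂P, ((S.cH k : ℂ) * ((C.H1hat ω)ᴴ *ᵥ w ω) (S.iI k)) = y) :
    ∫ ω, ‖C.rx k w ω‖ ^ 2 ∂P =
      (S.betaBI k - S.gammaH k) * ∫ ω, normSq (w ω) ∂P + ‖y‖ ^ 2 := by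
  have he := C.isWhite_err k
  have h1 : ∫ ω, ‖C.rx k w ω‖ ^ 2 ∂P = ∫ ω, ‖star (C.err k ω) ⬝ᵥ w ω + y‖ ^ 2 ∂P := by
    refine integral_congr_ae ?_
    filter_upwards [C.ae_rx_eq hy] with ω hω
    rw [hω]
  rw [h1, he.integral_norm_sq_dotProduct_add hw (memLp_const y)
    (hind.comp (φ := id) (ψ := fun x : Fin M → ℂ => (x, y)) measurable_id (by fun_prop))]
  simp

end Beam

/-! ### The zero-forcing precoders -/

section ZF

lemma measurable_zfBeam_apply (t : Fin KI) (m : Fin M) : Measurable fun ω => C.zfBeam t ω m :=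
  measurable_zfDir_apply C.measurable_H1hat_apply (S.iI t) m

variable [IsProbabilityMeasure P]

lemma ae_isUnit_det (k : Fin KI) (hM : τI < M) :
    ∀ᵐ ω ∂P, IsUnit ((C.H1hat ω)ᴴ * C.H1hat ω).det := by
  have h := ae_linearIndependent_pi_gaussVec hM.le
    (s := fun j => ⟨S.colVar j, (S.colVar_pos j).le⟩)
    (fun j => (show (0 : ℝ≥0) < ⟨S.colVar j, (S.colVar_pos j).le⟩ from S.colVar_pos j).ne')
  rw [← C.map_cols k] at h
  filter_upwards [ae_of_ae_map C.measurable_cols.aemeasurable h] with ω hω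
  rw [H1hat_eq_ofCols]
  exact isUnit_det_of_linearIndependent hω

lemma lintegral_normSq_zfBeam (hM : τI < M) (t : Fin KI) :
    ∫⁻ ω, ENNReal.ofReal (normSq (C.zfBeam t ω)) ∂P =
      ENNReal.ofReal (1 / (S.colVar (S.iI t) * ((M : ℝ) - τI))) := by
  have h := lintegral_normSq_zfDir_pi hM (s := fun j => ⟨S.colVar j, (S.colVar_pos j).le⟩)
    (fun j => (show (0 : ℝ≥0) < ⟨S.colVar j, (S.colVar_pos j).le⟩ from S.colVar_pos j).ne')
    (S.iI t)
  rw [← C.map_cols t, lintegral_map ?_ C.measurable_cols] at h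
  · simp_rw [← H1hat_eq_ofCols] at h
    exact h
  · exact (measurable_normSq fun m =>
      measurable_zfDir_apply measurable_ofCols_apply _ _).ennreal_ofReal

lemma integral_normSq_zfBeam (hM : τI < M) (t : Fin KI) :
    ∫ ω, normSq (C.zfBeam t ω) ∂P = 1 / (S.colVar (S.iI t) * ((M : ℝ) - τI)) := by
  have hpos : (0 : ℝ) < (M : ℝ) - τI := sub_pos.mpr (by exact_mod_cast hM)
  rw [integral_eq_lintegral_of_nonneg_ae (ae_of_all _ fun ω => normSq_nonneg _)
    (measurable_normSq (C.measurable_zfBeam_apply t)).aestronglyMeasurable,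
    C.lintegral_normSq_zfBeam hM t, ENNReal.toReal_ofReal]
  exact (one_div_pos.mpr (mul_pos (S.colVar_pos _) hpos)).le

lemma memLp_zfBeam (hM : τI < M) (t : Fin KI) (m : Fin M) :
    MemLp (fun ω => C.zfBeam t ω m) 2 P := by
  have hm := C.measurable_zfBeam_apply t
  rw [memLp_two_iff_integrable_sq_norm (hm m).aestronglyMeasurable]
  have hint : Integrable (fun ω => normSq (C.zfBeam t ω)) P := by
    refine (lintegral_ofReal_ne_top_iff_integrable (measurable_normSq hm).aestronglyMeasurable
      (ae_of_all _ fun ω => normSq_nonneg _)).mp ?_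
    rw [C.lintegral_normSq_zfBeam hM t]
    exact ENNReal.ofReal_ne_top
  refine hint.mono' ((hm m).norm.pow_const 2).aestronglyMeasurable (ae_of_all _ fun ω => ?_)
  rw [Real.norm_of_nonneg (by positivity)]
  exact Finset.single_le_sum (f := fun a => ‖C.zfBeam t ω a‖ ^ 2) (fun _ _ => by positivity)
    (Finset.mem_univ m)

lemma indepFun_err_zfBeam (k t : Fin KI) : IndepFun (C.err k) (C.zfBeam t) P := by
  have h : C.zfBeam t = fun ω => zfDir (ofCols (C.cols ω)) (S.iI t) := by
    funext ω
    rw [← H1hat_eq_ofCols]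
    rfl
  rw [h]
  exact (C.indepFun_err_cols k).comp (ψ := fun x => zfDir (ofCols x) (S.iI t)) measurable_id
    (measurable_pi_lambda _ fun m => measurable_zfDir_apply measurable_ofCols_apply _ _)

lemma ae_zfBeam_gain (hM : τI < M) (k t : Fin KI) :
    ∀ᵐ ω ∂P, ((S.cH k : ℂ) * ((C.H1hat ω)ᴴ *ᵥ C.zfBeam t ω) (S.iI k)) =
      if S.iI t = S.iI k then (S.cH k : ℂ) else 0 := by
  filter_upwards [C.ae_isUnit_det k hM] with ω hω
  have h : (C.H1hat ω)ᴴ *ᵥ C.zfBeam t ω = Pi.single (S.iI t) 1 :=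
    conjTranspose_mulVec_zfDir hω (S.iI t)
  rw [h, Pi.single_apply]
  simp [eq_comm]

lemma integral_normSq_zfBeam_pos (hM : τI < M) (t : Fin KI) :
    0 < ∫ ω, normSq (C.zfBeam t ω) ∂P := by
  rw [C.integral_normSq_zfBeam hM]
  exact one_div_pos.mpr (mul_pos (S.colVar_pos _) (sub_pos.mpr (by exact_mod_cast hM)))

lemma integral_normSq_wZF (hM : τI < M) (t : Fin KI) : ∫ ω, normSq (C.wZF t ω) ∂P = 1 :=
  integral_normSq_normalized (C.integral_normSq_zfBeam_pos hM t)

lemma memLp_rx_wZF (hM : τI < M) (k t : Fin KI) : MemLp (C.rx k (C.wZF t)) 2 P := by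
  have h := C.rx_smul k ((1 / Real.sqrt (∫ ω', normSq (C.zfBeam t ω') ∂P) : ℝ) : ℂ) (C.zfBeam t)
  change C.rx k (C.wZF t) = _ at h
  rw [h]
  exact (C.memLp_rx (C.memLp_zfBeam hM t) (C.indepFun_err_zfBeam k t)
    (C.ae_zfBeam_gain hM k t)).const_mul _

lemma norm_integral_rx_wZF_sq (hM : τI < M) (k : Fin KI) :
    ‖∫ ω, C.rx k (C.wZF k) ω ∂P‖ ^ 2 = ((M : ℝ) - τI) * S.gammaH k := by
  have hpos := C.integral_normSq_zfBeam_pos hM k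
  have h := C.rx_smul k ((1 / Real.sqrt (∫ ω', normSq (C.zfBeam k ω') ∂P) : ℝ) : ℂ) (C.zfBeam k)
  change C.rx k (C.wZF k) = _ at h
  rw [h, integral_const_mul, C.integral_rx (C.memLp_zfBeam hM k) (C.indepFun_err_zfBeam k k)
    (C.ae_zfBeam_gain hM k k), if_pos rfl, ← Complex.ofReal_mul, Complex.norm_real,
    Real.norm_eq_abs, sq_abs, mul_pow, div_pow, Real.sq_sqrt hpos.le, C.integral_normSq_zfBeam hM,
    S.gammaH_eq_sq]
  rw [one_pow, one_div_one_div]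
  ring

lemma integral_norm_sq_rx_wZF (hM : τI < M) (k t : Fin KI) :
    ∫ ω, ‖C.rx k (C.wZF t) ω‖ ^ 2 ∂P = (S.betaBI k - S.gammaH k) +
      if S.iI t = S.iI k then ((M : ℝ) - τI) * S.gammaH k else 0 := by
  have hpos := C.integral_normSq_zfBeam_pos hM t
  have h := C.rx_smul k ((1 / Real.sqrt (∫ ω', normSq (C.zfBeam t ω') ∂P) : ℝ) : ℂ) (C.zfBeam t)
  change C.rx k (C.wZF t) = _ at h
  rw [h]
  simp_rw [norm_mul, mul_pow, Complex.norm_real, Real.norm_eq_abs, sq_abs]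
  rw [integral_const_mul, C.integral_norm_sq_rx (C.memLp_zfBeam hM t) (C.indepFun_err_zfBeam k t)
    (C.ae_zfBeam_gain hM k t), div_pow, Real.sq_sqrt hpos.le, one_pow, mul_add]
  congr 1
  · field_simp
  · split_ifs with hkt
    · rw [C.integral_normSq_zfBeam hM, one_div_one_div, hkt, Complex.norm_real,
        Real.norm_eq_abs, sq_abs, S.gammaH_eq_sq]
      ring
    · simp

end ZF

/-! ### The protective precoders -/

section PMRT

/-- Both kinds of channel estimate of EU `l` are affine in the centered received signal. -/
lemma IsEstimate.exists_eq_mulVec_add {C : Fading S P} {l : Fin KE} {v : Ω → Fin M → ℂ}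
    (hv : C.IsEstimate l v) :
    ∃ (A : Matrix (Fin M) (Fin M) ℂ) (b : Fin M → ℂ), ∀ ω, v ω = A *ᵥ C.euSig l ω + b := by
  obtain ⟨c, hc⟩ := C.exists_yE_eq_lin_add l
  rcases hv with rfl | ⟨rfl, -⟩
  · refine ⟨(S.cG l : ℂ) • 1, (S.cG l : ℂ) • (c - (Real.sqrt S.tauP : ℂ) •
      ∑ l', (star (S.pilotE l') ⬝ᵥ S.pilotE l) • S.gMean l') + S.gMean l, fun ω => ?_⟩
    rw [gHat, hc, Matrix.smul_mulVec, Matrix.one_mulVec, add_sub_assoc, smul_add, add_assoc]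
    rfl
  · refine ⟨crossCov P (C.g l) (C.yE l) * (crossCov P (C.yE l) (C.yE l))⁻¹,
      (crossCov P (C.g l) (C.yE l) * (crossCov P (C.yE l) (C.yE l))⁻¹) *ᵥ
        (c - meanVec P (C.yE l)) + meanVec P (C.g l), fun ω => ?_⟩
    rw [mmse, hc, add_sub_assoc, Matrix.mulVec_add, add_assoc]
    rfl

variable [IsProbabilityMeasure P]

lemma integral_normSq_B_mulVec_gHat_pos (hN : 0 < N) (hM : τI < M) (k : Fin KI) (l : Fin KE) :
    0 < ∫ ω, normSq (C.B ω *ᵥ C.gHat l ω) ∂P := by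
  obtain ⟨c, hc⟩ := C.exists_yE_eq_lin_add l
  set b : Fin M → ℂ := (S.cG l : ℂ) • (c - (Real.sqrt S.tauP : ℂ) •
      ∑ l', (star (S.pilotE l') ⬝ᵥ S.pilotE l) • S.gMean l') + S.gMean l with hb
  have hcG := S.cG_pos hN l
  have hcG' : (S.cG l : ℂ) ≠ 0 := by exact_mod_cast hcG.ne'
  have h1 (ω : Ω) : C.gHat l ω = (S.cG l : ℂ) • (C.euSig l ω + (S.cG l : ℂ)⁻¹ • b) := by
    rw [smul_add, smul_smul, mul_inv_cancel₀ hcG', one_smul, hb, gHat, hc, add_sub_assoc,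
      smul_add, add_assoc]
    rfl
  have h2 (ω : Ω) : C.B ω = projCompl (ofCols (C.cols ω)) := by
    rw [← H1hat_eq_ofCols]
    rfl
  simp_rw [h1, h2, Matrix.mulVec_smul, normSq_smul]
  rw [integral_const_mul]
  exact mul_pos (by positivity) (integral_normSq_projCompl_mulVec_pos hM C.measurable_cols
    (S.euVar_pos l) (C.isWhite_euSig k l) (C.indepFun_euSig_cols k l) _)

lemma IsEstimate.integral_normSq_B_mulVec_pos {C : Fading S P} {l : Fin KE}
    {v : Ω → Fin M → ℂ} (hv : C.IsEstimate l v) (hN : 0 < N) (hM : τI < M) (k : Fin KI) :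
    0 < ∫ ω, normSq (C.B ω *ᵥ v ω) ∂P := by
  rcases hv with rfl | ⟨-, h⟩
  · exact C.integral_normSq_B_mulVec_gHat_pos hN hM k l
  · exact (integral_nonneg fun ω => normSq_nonneg _).lt_of_ne' h

lemma IsEstimate.memLp_B_mulVec {C : Fading S P} {l : Fin KE} {v : Ω → Fin M → ℂ}
    (hv : C.IsEstimate l v) (k : Fin KI) (m : Fin M) :
    MemLp (fun ω => (C.B ω *ᵥ v ω) m) 2 P := by
  obtain ⟨A, b, hA⟩ := hv.exists_eq_mulVec_add
  refine memLp_projCompl_mulVec C.measurable_H1hat_apply (v := v) (fun a => ?_) m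
  simp_rw [hA, Pi.add_apply, Matrix.mulVec, dotProduct]
  exact (memLp_finsetSum _ fun i _ => ((C.isWhite_euSig k l).memLp i).const_mul _).add
    (memLp_const _)

lemma IsEstimate.indepFun_err_B_mulVec {C : Fading S P} {l : Fin KE} {v : Ω → Fin M → ℂ}
    (hv : C.IsEstimate l v) (k : Fin KI) : IndepFun (C.err k) (fun ω => C.B ω *ᵥ v ω) P := by
  obtain ⟨A, b, hA⟩ := hv.exists_eq_mulVec_add
  have h : (fun ω => C.B ω *ᵥ v ω) =
      fun ω => projCompl (ofCols (C.cols ω)) *ᵥ (A *ᵥ C.euSig l ω + b) := by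
    funext ω
    rw [hA, ← H1hat_eq_ofCols]
    rfl
  rw [h]
  refine (C.indepFun_err_cols_euSig k l).comp (φ := id)
    (ψ := fun p : (Fin τI → Fin M → ℂ) × (Fin M → ℂ) => projCompl (ofCols p.1) *ᵥ (A *ᵥ p.2 + b))
    measurable_id (measurable_pi_lambda _ fun m => ?_)
  have hB (a : Fin M) : Measurable fun p : (Fin τI → Fin M → ℂ) × (Fin M → ℂ) =>
      projCompl (ofCols p.1) m a :=
    (measurable_projCompl_apply measurable_ofCols_apply m a).comp measurable_fst
  simp only [Matrix.mulVec, dotProduct, Pi.add_apply]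
  fun_prop

lemma ae_B_mulVec_gain (hM : τI < M) (k : Fin KI) (v : Ω → Fin M → ℂ) :
    ∀ᵐ ω ∂P, ((S.cH k : ℂ) * ((C.H1hat ω)ᴴ *ᵥ (C.B ω *ᵥ v ω)) (S.iI k)) = 0 := by
  filter_upwards [C.ae_isUnit_det k hM] with ω hω
  have h : (C.H1hat ω)ᴴ * C.B ω = 0 := conjTranspose_mul_projCompl hω
  rw [Matrix.mulVec_mulVec, h]
  simp

lemma memLp_rx_wPMRT (hM : τI < M) (k : Fin KI) {l : Fin KE} {v : Ω → Fin M → ℂ}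
    (hv : C.IsEstimate l v) : MemLp (C.rx k (C.wPMRT v)) 2 P := by
  have h := C.rx_smul k ((1 / Real.sqrt (∫ ω', normSq (C.B ω' *ᵥ v ω') ∂P) : ℝ) : ℂ)
    (fun ω => C.B ω *ᵥ v ω)
  change C.rx k (C.wPMRT v) = _ at h
  rw [h]
  exact (C.memLp_rx (hv.memLp_B_mulVec k) (hv.indepFun_err_B_mulVec k)
    (C.ae_B_mulVec_gain hM k v)).const_mul _

lemma integral_norm_sq_rx_wPMRT (hN : 0 < N) (hM : τI < M) (k : Fin KI) {l : Fin KE}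
    {v : Ω → Fin M → ℂ} (hv : C.IsEstimate l v) :
    ∫ ω, ‖C.rx k (C.wPMRT v) ω‖ ^ 2 ∂P = S.betaBI k - S.gammaH k := by
  have hpos := hv.integral_normSq_B_mulVec_pos hN hM k
  have h := C.rx_smul k ((1 / Real.sqrt (∫ ω', normSq (C.B ω' *ᵥ v ω') ∂P) : ℝ) : ℂ)
    (fun ω => C.B ω *ᵥ v ω)
  change C.rx k (C.wPMRT v) = _ at h
  rw [h]
  simp_rw [norm_mul, mul_pow, Complex.norm_real, Real.norm_eq_abs, sq_abs]
  rw [integral_const_mul, C.integral_norm_sq_rx (hv.memLp_B_mulVec k) (hv.indepFun_err_B_mulVec k)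
    (C.ae_B_mulVec_gain hM k v), div_pow, Real.sq_sqrt hpos.le]
  field_simp
  simp

end PMRT

/-! ### Closed forms of the SINR -/

lemma sinr_eq [IsProbabilityMeasure P] (hN : 0 < N) (hM : τI < M) {v : Fin KE → Ω → Fin M → ℂ}
    (hv : ∀ l, C.IsEstimate l (v l)) (k : Fin KI) :
    C.sinr C.wZF (fun l => C.wPMRT (v l)) k = S.sinrPPZF k := by
  unfold sinr Params.sinrPPZF
  simp_rw [C.norm_integral_rx_wZF_sq hM, C.integral_norm_sq_rx_wZF hM,
    C.integral_norm_sq_rx_wPMRT hN hM k (hv _)]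
  have hmem : k ∈ S.sharing k := by simp [Params.sharing]
  have h1 : ∑ t, S.rhoI t * ((S.betaBI k - S.gammaH k) +
      if S.iI t = S.iI k then ((M : ℝ) - τI) * S.gammaH k else 0) =
      ∑ t, S.rhoI t * (S.betaBI k - S.gammaH k) +
        (S.rhoI k * (((M : ℝ) - τI) * S.gammaH k) +
          ∑ t ∈ (S.sharing k).erase k, ((M : ℝ) - τI) * S.rhoI t * S.gammaH k) := by
    simp_rw [mul_add, Finset.sum_add_distrib, mul_ite, mul_zero]
    congr 1
    rw [← Finset.sum_filter]
    change ∑ t ∈ S.sharing k, _ = _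
    rw [← Finset.add_sum_erase _ _ hmem]
    congr 1
    refine Finset.sum_congr rfl fun t _ => ?_
    ring
  rw [h1]
  congr 1 <;> ring

end Fading

namespace Params

variable {M N KI KE τI τE : ℕ} (S : Params M N KI KE τI τE)

lemma injective_iI_of_orthogonal
    (horth : ∀ t t', t ≠ t' → star (S.pilotI t) ⬝ᵥ S.pilotI t' = 0) :
    Function.Injective S.iI := by
  intro t t' h
  by_contra hne
  have h1 := horth t t' hne
  rw [pilotI_dotProduct, if_pos h] at h1
  exact one_ne_zero h1

lemma gammaH_of_injective (hinj : Function.Injective S.iI) (k : Fin KI) :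
    S.gammaH k = S.tauP * S.betaBI k ^ 2 / (S.tauP * S.betaBI k + S.noiseVar) := by
  rw [gammaH_eq, colVar]
  simp [hinj.eq_iff]

lemma sinrPPZF_of_bijective (hbij : Function.Bijective S.iI) (k : Fin KI) :
    S.sinrPPZF k = S.sinrPPZFOrth k := by
  have hcard : KI = τI := by simpa using Fintype.card_of_bijective hbij
  have hshare : (S.sharing k).erase k = ∅ := by
    ext t
    simp only [sharing, Finset.mem_erase, Finset.mem_filter, Finset.mem_univ, true_and,
      Finset.notMem_empty, iff_false, not_and]
    exact fun hne h => hne (hbij.1 h)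
  rw [sinrPPZF, sinrPPZFOrth, hshare, Finset.sum_empty, zero_add, ← (congrArg Nat.cast hcard :
    (KI : ℝ) = τI)]

end Params

end Swipt

end

theorem proposition3 {M N KI KE τI τE : ℕ} (S : Swipt.Params M N KI KE τI τE)
    {Ω : Type*} [MeasurableSpace Ω] (P : Measure Ω) [IsProbabilityMeasure P]
    (C : Swipt.Fading S P) (hN : 0 < N) (hM : τI < M)
    (v : Fin KE → Ω → Fin M → ℂ) (hv : ∀ l, C.IsEstimate l (v l)) (k : Fin KI) :
    -- the estimates, the precoders and all expectations involved are well defined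
    (∀ᵐ ω ∂P, IsUnit ((C.H1hat ω)ᴴ * C.H1hat ω).det) ∧
    (∀ m, MemLp (fun ω => C.hHat k ω m) 2 P ∧ ∫ ω, ‖C.hHat k ω m‖ ^ 2 ∂P = S.gammaH k) ∧
    (∀ t, ∫ ω, Swipt.normSq (C.wZF t ω) ∂P = 1) ∧
    (∀ l, ∫ ω, Swipt.normSq (C.wPMRT (v l) ω) ∂P = 1) ∧
    (∀ t, MemLp (C.rx k (C.wZF t)) 2 P) ∧
    (∀ l, MemLp (C.rx k (C.wPMRT (v l))) 2 P) ∧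
    -- closed form with pilot sharing
    C.sinr C.wZF (fun l => C.wPMRT (v l)) k = S.sinrPPZF k ∧
    C.se C.wZF (fun l => C.wPMRT (v l)) k = S.spectralEfficiency (S.sinrPPZF k) ∧
    -- closed form for mutually orthogonal IU pilots
    (Function.Surjective S.iI →
      (∀ t t', t ≠ t' → star (S.pilotI t) ⬝ᵥ S.pilotI t' = 0) →
        S.gammaH k = S.tauP * S.betaBI k ^ 2 / (S.tauP * S.betaBI k + S.noiseVar) ∧
        C.sinr C.wZF (fun l => C.wPMRT (v l)) k = S.sinrPPZFOrth k ∧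
        C.se C.wZF (fun l => C.wPMRT (v l)) k = S.spectralEfficiency (S.sinrPPZFOrth k)) := by
  have hsinr := C.sinr_eq hN hM hv k
  have hse : C.se C.wZF (fun l => C.wPMRT (v l)) k = S.spectralEfficiency (S.sinrPPZF k) :=
    congrArg S.spectralEfficiency hsinr
  refine ⟨C.ae_isUnit_det k hM, fun m => ⟨C.memLp_hHat k m, C.integral_norm_sq_hHat k m⟩,
    C.integral_normSq_wZF hM, fun l => Swipt.Fading.integral_normSq_normalized
      ((hv l).integral_normSq_B_mulVec_pos hN hM k), C.memLp_rx_wZF hM k,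
    fun l => C.memLp_rx_wPMRT hM k (hv l), hsinr, hse, fun hsurj horth => ?_⟩
  have hinj := S.injective_iI_of_orthogonal horth
  have horth_eq := S.sinrPPZF_of_bijective ⟨hinj, hsurj⟩ k
  exact ⟨S.gammaH_of_injective hinj k, hsinr.trans horth_eq, hse.trans (by rw [horth_eq])⟩
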